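/- **Setting.** Let $A:\mathbb R^p\to\mathbb R^{n\times n}$, $B:\mathbb R^p\to\mathbb R^{n\times m}$ be affine, let $Q,R\succ0$ be symmetric, and let $\|\cdot\|$ be the Euclidean norm. Write $A(\theta)x+B(\theta)u=\delta(x,u)+D(x,u)\theta$ with $\delta(x,u)=A(0)x+B(0)u$ and $D(x,u)\in\mathbb R^{n\times p}$ linear in $(x,u)$. A pair $(M,N)$ is stabilizable if $M+NK$ is Schur stable (all eigenvalues of modulus $<1$) for some $K$. If $(A(\theta),B(\theta))$ is stabilizable, let $P(\theta)\succ0$ be the positive definite solution of $$P=A^\top PA-A^\top PB(R+B^\top PB)^{-1}B^\top PA+Q,\qquad A=A(\theta),\ B=B(\theta),$$ and put $K(\theta)=-(R+B^\top PB)^{-1}B^\top PA$, $V(x,\theta)=x^\top P(\theta)x$. For a compact convex $\Theta\subset\mathbb R^p$, a step size $\mu>0$, parameters $\theta_k\in\Theta$, disturbances $w_k\in\mathbb R^n$, an initial state $x_0$ and an initial estimate $\hat\theta_0\in\Theta$, the closed loop is, for $k\in\mathbb N$, $$x_{k+1}=A(\theta_k)x_k+B(\theta_k)u_k+w_k,\qquad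 u_k=K(\hat\theta_k)x_k,$$ $$\hat\theta_{k+1}=\Pi_\Theta\big[\hat\theta_k+\mu D(x_k,u_k)^\top\big(x_{k+1}-A(\hat\theta_k)x_k-B(\hat\theta_k)u_k\big)\big],$$ where $\Pi_\Theta$ is the Euclidean projection onto $\Theta$. Put $\varphi_k=\hat\theta_k-\theta_k$, $\Delta\theta_k=\theta_{k+1}-\theta_k$, $e_k=x_{k+1}-A(\hat\theta_k)x_k-B(\hat\theta_k)u_k-w_k$, and, for $\beta>0$, $\tilde V(x,\varphi,k)=V(x,\varphi+\theta_k)+\frac{\beta}{\mu}\|\varphi\|^2$. **Theorem.** Let $\Theta_0\subset\mathbb R^p$ be a compact set such that $(A(\theta),B(\theta))$ is stabilizable for every $\theta\in\Theta_0$. There is $d_0>0$, depending only on $A,B,Q,R,\Theta_0$, such that for every compact convex $\Theta\subseteq\Theta_0$ of diameter at most $d_0$, and all $\bar W,r\ge0$, there is $\mu_0>0$ such that for every step size $0<\mu\le\mu_0$ there are constants $X,U,\alpha,\beta,\gamma,\tilde\alpha,\tilde\gamma,\tilde\delta,\underline c,\bar c,c_1,c_2,c_3,c_4>0$ with the following properties.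 For every closed-loop trajectory with $\theta_k\in\Theta$ and $\|w_k\|\le\bar W$ for all $k$, $\|x_0\|\le r$ and $\hat\theta_0\in\Theta$: (a) $\|x_k\|\le X$ and $\|u_k\|\le U$ for all $k\in\mathbb N$; (b) for all $k\in\mathbb N$, $V(x_{k+1},\hat\theta_{k+1})-V(x_k,\hat\theta_k)\le-\alpha\|x_k\|^2+\beta\|e_k\|^2+\gamma\|w_k\|^2$, and, with this $\beta$ in $\tilde V$, $$\underline c\,(\|x_k\|^2+\|\varphi_k\|^2)\le\tilde V(x_k,\varphi_k,k)\le\bar c\,(\|x_k\|^2+\|\varphi_k\|^2),$$ $$\tilde V(x_{k+1},\varphi_{k+1},k+1)-\tilde V(x_k,\varphi_k,k)\le-\tilde\alpha\|x_k\|^2+\tilde\gamma\|w_k\|^2+\tilde\delta\|\Delta\theta_k\|;$$ (c) for all $T\in\mathbb N$, $$\sum_{k=0}^T\|x_k\|^2\le c_1\|x_0\|^2+c_2\|\varphi_0\|^2+c_3\sum_{k=0}^T\|w_k\|^2+c_4\sum_{k=0}^T\|\Delta\theta_k\|.$$ In particular the state is finite-gain $\ell^2$-stable with respect to the disturbance when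 $\{\Delta\theta\}\in\ell^1$: for every sequence $\theta_k\in\Theta$ with $\sum_k\|\Delta\theta_k\|<\infty$, every $x_0$ with $\|x_0\|\le r$ and every $\hat\theta_0\in\Theta$ there are $g_1,g_2\ge0$ with $\sum_{k=0}^T\|x_k\|^2\le g_1\sum_{k=0}^T\|w_k\|^2+g_2$ for all $T\in\mathbb N$ and all square-summable $w$ with $\|w_k\|\le\bar W$ for all $k$. -/

import Mathlib

open Matrix

/-- Column vectors with the Euclidean norm. -/
abbrev EVec (n : ℕ) : Type := EuclideanSpace ℝ (Fin n)

/-- A real square matrix is Schur stable if all its complex eigenvalues have modulus `< 1`. -/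
def IsSchurStable {n : ℕ} (M : Matrix (Fin n) (Fin n) ℝ) : Prop :=
  ∀ z ∈ spectrum ℂ (M.map (algebraMap ℝ ℂ)), ‖z‖ < 1

/-- The pair `(M, N)` is (discrete-time) stabilizable: some static state feedback makes the closed
loop Schur stable. -/
def IsStabilizable {n m : ℕ} (M : Matrix (Fin n) (Fin n) ℝ) (N : Matrix (Fin n) (Fin m) ℝ) :
    Prop :=
  ∃ K : Matrix (Fin m) (Fin n) ℝ, IsSchurStable (M + N * K)

/-- `P` solves the discrete-time algebraic Riccati equation of `(M, N)` with weights `Q`, `R`. -/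
def SolvesDARE {n m : ℕ} (M : Matrix (Fin n) (Fin n) ℝ) (N : Matrix (Fin n) (Fin m) ℝ)
    (Q : Matrix (Fin n) (Fin n) ℝ) (R : Matrix (Fin m) (Fin m) ℝ)
    (P : Matrix (Fin n) (Fin n) ℝ) : Prop :=
  P = Mᵀ * P * M - Mᵀ * P * N * (R + Nᵀ * P * N)⁻¹ * Nᵀ * P * M + Q

/-- The positive definite solution of the Riccati equation (an arbitrary matrix if there is no such
solution). -/
noncomputable def dareSolution {n m : ℕ} (M : Matrix (Fin n) (Fin n) ℝ)
    (N : Matrix (Fin n) (Fin m) ℝ) (Q : Matrix (Fin n) (Fin n) ℝ)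
    (R : Matrix (Fin m) (Fin m) ℝ) : Matrix (Fin n) (Fin n) ℝ :=
  Classical.epsilon fun P => P.PosDef ∧ SolvesDARE M N Q R P

/-- The LQR gain `-(R + Nᵀ P N)⁻¹ Nᵀ P M`, `P` the solution of the Riccati equation. -/
noncomputable def lqrGain {n m : ℕ} (M : Matrix (Fin n) (Fin n) ℝ)
    (N : Matrix (Fin n) (Fin m) ℝ) (Q : Matrix (Fin n) (Fin n) ℝ)
    (R : Matrix (Fin m) (Fin m) ℝ) : Matrix (Fin m) (Fin n) ℝ :=
  -((R + Nᵀ * dareSolution M N Q R * N)⁻¹ * Nᵀ * dareSolution M N Q R * M)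

/-- The value `A(ϑ) x + B(ϑ) u`: the noise-free successor state under the parameter `ϑ`. -/
noncomputable def nominalStep {n m p : ℕ} (A : EVec p →ᵃ[ℝ] Matrix (Fin n) (Fin n) ℝ)
    (B : EVec p →ᵃ[ℝ] Matrix (Fin n) (Fin m) ℝ) (ϑ : EVec p) (x : EVec n) (u : EVec m) : EVec n :=
  toEuclideanLin (A ϑ) x + toEuclideanLin (B ϑ) u

/-- The regressor matrix `D(x, u)`, whose `j`-th column is `A'(e_j) x + B'(e_j) u`, where `A'`, `B'`
are the linear parts of the affine maps `A`, `B`. -/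
noncomputable def regressor {n m p : ℕ} (A : EVec p →ᵃ[ℝ] Matrix (Fin n) (Fin n) ℝ)
    (B : EVec p →ᵃ[ℝ] Matrix (Fin n) (Fin m) ℝ) (x : EVec n) (u : EVec m) :
    Matrix (Fin n) (Fin p) ℝ :=
  Matrix.of fun i j =>
    (toEuclideanLin (A.linear (EuclideanSpace.single j 1)) x +
      toEuclideanLin (B.linear (EuclideanSpace.single j 1)) u) i

/-- `D(x, u)` is the matrix for which the dynamics read `δ(x, u) + D(x, u) ϑ`, where
`δ(x, u) = A(0) x + B(0) u`. -/
theorem nominalStep_eq_regressor {n m p : ℕ} (A : EVec p →ᵃ[ℝ] Matrix (Fin n) (Fin n) ℝ)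
    (B : EVec p →ᵃ[ℝ] Matrix (Fin n) (Fin m) ℝ) (ϑ : EVec p) (x : EVec n) (u : EVec m) :
    nominalStep A B ϑ x u = nominalStep A B 0 x u + toEuclideanLin (regressor A B x u) ϑ := by
  have key : toEuclideanLin (regressor A B x u) ϑ =
      toEuclideanLin (A.linear ϑ) x + toEuclideanLin (B.linear ϑ) u := by
    have hϑ : ϑ = ∑ j, ϑ j • EuclideanSpace.single j (1 : ℝ) := by
      ext i
      simp [Finset.sum_apply, Pi.single_apply]
    conv_rhs => rw [hϑ]
    simp only [map_sum, map_smul, LinearMap.sum_apply, LinearMap.smul_apply]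
    rw [← Finset.sum_add_distrib]
    ext i
    simp [regressor, toLpLin_apply, mulVec, dotProduct, mul_comm, mul_add]
  have hA : A ϑ = A.linear ϑ + A 0 := by
    simpa using A.map_vadd 0 ϑ
  have hB : B ϑ = B.linear ϑ + B 0 := by
    simpa using B.map_vadd 0 ϑ
  rw [key, nominalStep, nominalStep, hA, hB]
  simp only [map_add, LinearMap.add_apply]
  abel

/-- `z` is the projection of `y` onto `S`: a point of `S` of minimal distance to `y`. -/
def IsProjection {p : ℕ} (S : Set (EVec p)) (y z : EVec p) : Prop :=
  z ∈ S ∧ ∀ z' ∈ S, ‖z - y‖ ≤ ‖z' - y‖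

/-- The sequences `x` (state), `u` (input), `θhat` (parameter estimate) form a trajectory of the
closed loop of the linear time-varying system with parameters `θ` and disturbances `w`, the
certainty-equivalent LQR with weights `Q`, `R`, and the projected least mean square estimator with
parameter set `Θ` and step size `μ`. -/
structure IsClosedLoop {n m p : ℕ} (A : EVec p →ᵃ[ℝ] Matrix (Fin n) (Fin n) ℝ)
    (B : EVec p →ᵃ[ℝ] Matrix (Fin n) (Fin m) ℝ) (Q : Matrix (Fin n) (Fin n) ℝ)
    (R : Matrix (Fin m) (Fin m) ℝ) (Θ : Set (EVec p)) (μ : ℝ) (θ : ℕ → EVec p) (w : ℕ → EVec n)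
    (x : ℕ → EVec n) (u : ℕ → EVec m) (θhat : ℕ → EVec p) : Prop where
  system : ∀ k, x (k + 1) = nominalStep A B (θ k) (x k) (u k) + w k
  control : ∀ k, u k = toEuclideanLin (lqrGain (A (θhat k)) (B (θhat k)) Q R) (x k)
  init : θhat 0 ∈ Θ
  estimator : ∀ k, IsProjection Θ
    (θhat k + μ • toEuclideanLin (regressor A B (x k) (u k))ᵀ
      (x (k + 1) - nominalStep A B (θhat k) (x k) (u k)))
    (θhat (k + 1))

/-- The LQR Lyapunov function `V(x, ϑ) = xᵀ P(ϑ) x`. -/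
noncomputable def lqrLyapunov {n m p : ℕ} (A : EVec p →ᵃ[ℝ] Matrix (Fin n) (Fin n) ℝ)
    (B : EVec p →ᵃ[ℝ] Matrix (Fin n) (Fin m) ℝ) (Q : Matrix (Fin n) (Fin n) ℝ)
    (R : Matrix (Fin m) (Fin m) ℝ) (x : EVec n) (ϑ : EVec p) : ℝ :=
  x.ofLp ⬝ᵥ (dareSolution (A ϑ) (B ϑ) Q R *ᵥ x.ofLp)

/-- The joint Lyapunov function of state `x` and estimation error `φ` at time `k`:
`V(x, φ + θ_k) + (β / μ) ‖φ‖²`. -/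
noncomputable def jointLyapunov {n m p : ℕ} (A : EVec p →ᵃ[ℝ] Matrix (Fin n) (Fin n) ℝ)
    (B : EVec p →ᵃ[ℝ] Matrix (Fin n) (Fin m) ℝ) (Q : Matrix (Fin n) (Fin n) ℝ)
    (R : Matrix (Fin m) (Fin m) ℝ) (θ : ℕ → EVec p) (β μ : ℝ) (x : EVec n) (φ : EVec p) (k : ℕ) :
    ℝ :=
  lqrLyapunov A B Q R x (φ + θ k) + β / μ * ‖φ‖ ^ 2

/-- Finite-gain `ℓ²`-stability with respect to the disturbance. `traj w x` says that `x` is a state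
trajectory generated by the (admissible) disturbance signal `w`. -/
def IsFiniteGainL2Stable {n : ℕ} (traj : (ℕ → EVec n) → (ℕ → EVec n) → Prop) : Prop :=
  ∃ g₁ g₂ : ℝ, 0 ≤ g₁ ∧ 0 ≤ g₂ ∧ ∀ w x : ℕ → EVec n, traj w x → Summable (fun k => ‖w k‖ ^ 2) →
    ∀ T : ℕ, ∑ k ∈ Finset.range (T + 1), ‖x k‖ ^ 2 ≤
      g₁ * ∑ k ∈ Finset.range (T + 1), ‖w k‖ ^ 2 + g₂

/-! Under the gain of the current estimate, the true loop is the LQR loop of the model `θhat k`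
driven by `e_k + w_k`. The Riccati identity makes `V(·, θhat k)` drop by at least `q‖x_k‖²`, where
`q‖x‖² ≤ xᵀQx`. Young's inequality for the perturbation and the passage from `θhat k` to `θhat (k +
1)` each give back `(q/4)‖x_k‖²`; the latter because on a set of small diameter the value functions
agree up to the factor `1 + q/(4Λ)`, with `V ≤ Λ‖x‖²`. What remains is `V_{k+1} - V_k ≤ -(q/2)‖x_k‖²
+ β‖e_k‖² + β‖w_k‖²`.

This inequality is used twice. First, `θ k` and `θhat k` both lie in `Θ`, so for small diameter
`β‖e_k‖²` is at most `(q/4)‖x_k‖²`, and the state stays below a bound that does not involve `μ`.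
This removes the circularity: the bound controls the regressor, and only then is `μ₀` chosen.
Second, for `μ ≤ μ₀` a gradient step lowers `‖φ‖²` by `μ‖e_k‖²`, up to `3μ‖w_k‖²`; the projection
does no harm and the drift of `θ` costs `3d‖Δθ_k‖`. Adding `(β/μ)‖φ‖²` to `V` therefore cancels
`β‖e_k‖²`, and summation gives (c).

The Riccati facts rest on one comparison principle, `quadForm_le_of_supersolution`: a matrix
dominating its own one-step cost under some gain dominates every positive semidefinite Riccati
solution. Stabilizability provides such supersolutions, and one of least trace solves the equation.
Inflating `P(ϑ)` by `1 + s` gives a supersolution for all nearby parameters, so value functions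
compare at a distance depending on `P(ϑ)` only through its upper bound `Λ`; compactness of `Θ₀`
makes `Λ` uniform. -/

/-! ### Quadratic forms on Euclidean space. -/

section QuadraticForms

/-- The quadratic form `xᵀ P x` on Euclidean space. -/
def quadForm {n : ℕ} (P : Matrix (Fin n) (Fin n) ℝ) (x : EVec n) : ℝ :=
  x.ofLp ⬝ᵥ (P *ᵥ x.ofLp)

variable {n m : ℕ}

theorem quadForm_eq_inner (P : Matrix (Fin n) (Fin n) ℝ) (x : EVec n) :
    quadForm P x = inner ℝ x (toEuclideanLin P x) := by
  rw [EuclideanSpace.inner_eq_star_dotProduct, star_trivial, dotProduct_comm]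
  rfl

theorem toEuclideanLin_mul_apply {l : ℕ} (M : Matrix (Fin l) (Fin m) ℝ)
    (N : Matrix (Fin m) (Fin n) ℝ) (x : EVec n) :
    toEuclideanLin (M * N) x = toEuclideanLin M (toEuclideanLin N x) := by
  rw [toLpLin_mul 2 2 2]
  rfl

theorem inner_toEuclideanLin_transpose (M : Matrix (Fin m) (Fin n) ℝ) (x : EVec n) (y : EVec m) :
    inner ℝ (toEuclideanLin Mᵀ y) x = inner ℝ y (toEuclideanLin M x) := by
  simp only [EuclideanSpace.inner_eq_star_dotProduct, star_trivial, toLpLin_apply]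
  rw [dotProduct_comm (M *ᵥ x.ofLp), dotProduct_mulVec, vecMul_transpose, dotProduct_comm]

theorem quadForm_toEuclideanLin (P : Matrix (Fin m) (Fin m) ℝ) (M : Matrix (Fin m) (Fin n) ℝ)
    (x : EVec n) : quadForm P (toEuclideanLin M x) = quadForm (Mᵀ * P * M) x := by
  rw [quadForm_eq_inner, quadForm_eq_inner, toEuclideanLin_mul_apply, toEuclideanLin_mul_apply]
  conv_rhs => rw [real_inner_comm, inner_toEuclideanLin_transpose, real_inner_comm]

theorem quadForm_add_matrix (P P' : Matrix (Fin n) (Fin n) ℝ) (x : EVec n) :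
    quadForm (P + P') x = quadForm P x + quadForm P' x := by
  simp [quadForm, add_mulVec, dotProduct_add]

theorem quadForm_sub_matrix (P P' : Matrix (Fin n) (Fin n) ℝ) (x : EVec n) :
    quadForm (P - P') x = quadForm P x - quadForm P' x := by
  simp [quadForm, sub_mulVec, dotProduct_sub]

theorem quadForm_smul_matrix (c : ℝ) (P : Matrix (Fin n) (Fin n) ℝ) (x : EVec n) :
    quadForm (c • P) x = c * quadForm P x := by
  simp [quadForm, smul_mulVec, dotProduct_smul]

theorem quadForm_sum_matrix {ι : Type*} (s : Finset ι) (P : ι → Matrix (Fin n) (Fin n) ℝ)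
    (x : EVec n) : quadForm (∑ i ∈ s, P i) x = ∑ i ∈ s, quadForm (P i) x := by
  simp [quadForm, sum_mulVec, dotProduct_sum]

theorem quadForm_nonneg {P : Matrix (Fin n) (Fin n) ℝ} (hP : P.PosSemidef) (x : EVec n) :
    0 ≤ quadForm P x := by
  simpa [quadForm] using hP.dotProduct_mulVec_nonneg x.ofLp

theorem posSemidef_of_quadForm_nonneg {P : Matrix (Fin n) (Fin n) ℝ} (hP : Pᵀ = P)
    (h : ∀ x : EVec n, 0 ≤ quadForm P x) : P.PosSemidef :=
  .of_dotProduct_mulVec_nonneg (by simpa [IsHermitian] using hP)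
    fun x => by simpa [quadForm] using h (WithLp.toLp 2 x)

theorem continuous_quadForm (P : Matrix (Fin n) (Fin n) ℝ) : Continuous (quadForm P) := by
  have : quadForm P = fun x => inner ℝ x (toEuclideanLin P x) := funext (quadForm_eq_inner P)
  rw [this]
  exact continuous_id.inner (LinearMap.continuous_of_finiteDimensional _)

theorem quadForm_smul (P : Matrix (Fin n) (Fin n) ℝ) (c : ℝ) (x : EVec n) :
    quadForm P (c • x) = c ^ 2 * quadForm P x := by
  simp only [quadForm_eq_inner, map_smul, inner_smul_left, inner_smul_right]
  simp
  ring

/-- Young's inequality for a positive semidefinite quadratic form. -/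
theorem quadForm_add_le {P : Matrix (Fin n) (Fin n) ℝ} (hP : P.PosSemidef) {s : ℝ} (hs : 0 < s)
    (x y : EVec n) :
    quadForm P (x + y) ≤ (1 + s) * quadForm P x + (1 + 1 / s) * quadForm P y := by
  have h := quadForm_nonneg hP (s • x - y)
  -- The defect in Young's inequality, scaled by `s`, is itself a value of the form.
  have key : s * ((1 + s) * quadForm P x + (1 + 1 / s) * quadForm P y - quadForm P (x + y)) =
      quadForm P (s • x - y) := by
    simp only [quadForm_eq_inner, map_add, map_sub, map_smul, inner_add_left, inner_add_right,
      inner_sub_left, inner_sub_right, inner_smul_left, inner_smul_right]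
    simp only [conj_trivial]
    field_simp
    ring
  nlinarith [nonneg_of_mul_nonneg_right (key ▸ h) hs]

/-- A positive definite form is bounded below by a multiple of the squared norm. -/
theorem exists_le_quadForm {P : Matrix (Fin n) (Fin n) ℝ} (hP : P.PosDef) :
    ∃ q : ℝ, 0 < q ∧ ∀ x : EVec n, q * ‖x‖ ^ 2 ≤ quadForm P x := by
  obtain hn | hn := (Metric.sphere (0 : EVec n) 1).eq_empty_or_nonempty
  -- An empty unit sphere means the space is zero, so any constant works.
  · refine ⟨1, one_pos, fun x => ?_⟩
    obtain rfl : x = 0 := by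
      by_contra hx
      have : (‖x‖⁻¹ • x) ∈ Metric.sphere (0 : EVec n) 1 := by
        simp [norm_smul, norm_ne_zero_iff.2 hx]
      simp [hn] at this
    simp [quadForm]
  · obtain ⟨z, hz, hmin⟩ := (isCompact_sphere (0 : EVec n) 1).exists_isMinOn hn
      (continuous_quadForm P).continuousOn
    have hz0 : z.ofLp ≠ 0 := by
      intro h
      have : z = 0 := by ext i; simp [h]
      simp [this] at hz
    refine ⟨quadForm P z, by simpa [quadForm] using hP.dotProduct_mulVec_pos hz0, fun x => ?_⟩
    by_cases hx : x = 0
    · simp [hx, quadForm]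
    have hx' : ‖x‖ ≠ 0 := norm_ne_zero_iff.2 hx
    have h1 : quadForm P z ≤ quadForm P (‖x‖⁻¹ • x) :=
      hmin (by simp [norm_smul, hx'])
    rw [quadForm_smul] at h1
    calc quadForm P z * ‖x‖ ^ 2 ≤ (‖x‖⁻¹ ^ 2 * quadForm P x) * ‖x‖ ^ 2 := by gcongr
      _ = quadForm P x := by field_simp

theorem exists_norm_toEuclideanLin_le (M : Matrix (Fin m) (Fin n) ℝ) :
    ∃ C : ℝ, 0 < C ∧ ∀ x : EVec n, ‖toEuclideanLin M x‖ ≤ C * ‖x‖ := by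
  obtain ⟨C, hC, h⟩ := (toEuclideanLin M).toContinuousLinearMap.isBoundedLinearMap.bound
  exact ⟨C, hC, h⟩

theorem exists_quadForm_le (P : Matrix (Fin n) (Fin n) ℝ) :
    ∃ C : ℝ, 0 < C ∧ ∀ x : EVec n, quadForm P x ≤ C * ‖x‖ ^ 2 := by
  obtain ⟨C, hC, h⟩ := exists_norm_toEuclideanLin_le P
  refine ⟨C, hC, fun x => ?_⟩
  rw [quadForm_eq_inner]
  calc _ ≤ ‖x‖ * ‖toEuclideanLin P x‖ := real_inner_le_norm _ _
    _ ≤ ‖x‖ * (C * ‖x‖) := by gcongr; exact h x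
    _ = _ := by ring

end QuadraticForms

/-! ### The Riccati operator, completion of squares and the comparison principle. -/

section Riccati

variable {n m : ℕ} (M : Matrix (Fin n) (Fin n) ℝ) (N : Matrix (Fin n) (Fin m) ℝ)
  (Q : Matrix (Fin n) (Fin n) ℝ) (R : Matrix (Fin m) (Fin m) ℝ)

/-- The minimizing gain `-(R + Nᵀ P N)⁻¹ Nᵀ P M` of the one-step cost with terminal weight `P`. -/
noncomputable def riccatiGain (P : Matrix (Fin n) (Fin n) ℝ) : Matrix (Fin m) (Fin n) ℝ :=
  -((R + Nᵀ * P * N)⁻¹ * Nᵀ * P * M)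

/-- The right-hand side of the Riccati equation. -/
noncomputable def riccatiMap (P : Matrix (Fin n) (Fin n) ℝ) : Matrix (Fin n) (Fin n) ℝ :=
  Mᵀ * P * M - Mᵀ * P * N * (R + Nᵀ * P * N)⁻¹ * Nᵀ * P * M + Q

/-- The matrix of the one-step cost of the gain `K` with terminal weight `P`. -/
def feedbackMap (K : Matrix (Fin m) (Fin n) ℝ) (P : Matrix (Fin n) (Fin n) ℝ) :
    Matrix (Fin n) (Fin n) ℝ :=
  (M + N * K)ᵀ * P * (M + N * K) + Kᵀ * R * K + Q

variable {M N Q R}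

theorem quadForm_feedbackMap (K : Matrix (Fin m) (Fin n) ℝ) (P : Matrix (Fin n) (Fin n) ℝ)
    (x : EVec n) : quadForm (feedbackMap M N Q R K P) x =
      quadForm P (toEuclideanLin (M + N * K) x) + quadForm R (toEuclideanLin K x) +
        quadForm Q x := by
  simp only [feedbackMap, quadForm_add_matrix, quadForm_toEuclideanLin]

theorem posDef_add_conj (hR : R.PosDef) {P : Matrix (Fin n) (Fin n) ℝ} (hP : P.PosSemidef) :
    (R + Nᵀ * P * N).PosDef := by
  have := hP.conjTranspose_mul_mul_same N
  rw [conjTranspose_eq_transpose_of_trivial] at this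
  exact hR.add_posSemidef this

theorem Matrix.PosSemidef.transpose_eq {P : Matrix (Fin n) (Fin n) ℝ} (hP : P.PosSemidef) :
    Pᵀ = P := by
  simpa [IsHermitian] using hP.isHermitian

/-- Completing the square in the one-step cost. -/
theorem feedbackMap_eq (hR : R.PosDef) {P : Matrix (Fin n) (Fin n) ℝ} (hP : P.PosSemidef)
    (K : Matrix (Fin m) (Fin n) ℝ) :
    feedbackMap M N Q R K P = riccatiMap M N Q R P +
      (K - riccatiGain M N R P)ᵀ * (R + Nᵀ * P * N) * (K - riccatiGain M N R P) := by
  have hG := posDef_add_conj (N := N) hR hP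
  set G := R + Nᵀ * P * N with hGdef
  set L := riccatiGain M N R P with hL
  have hdet : IsUnit G.det := (isUnit_iff_isUnit_det _).1 hG.isUnit
  have h1 : G * L = -(Nᵀ * P * M) := by
    rw [hL, riccatiGain, ← hGdef, Matrix.mul_neg, Matrix.mul_assoc, Matrix.mul_assoc,
      mul_nonsing_inv_cancel_left _ _ hdet, ← Matrix.mul_assoc]
  have h2 : Lᵀ * G = -(Mᵀ * P * N) := by
    have := congrArg transpose h1
    rw [transpose_mul, hG.posSemidef.transpose_eq] at this
    rw [this]
    simp [transpose_mul, hP.transpose_eq, Matrix.mul_assoc]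
  have h3 : riccatiMap M N Q R P = Mᵀ * P * M + Mᵀ * P * N * L + Q := by
    rw [hL, riccatiGain, riccatiMap, ← hGdef]
    simp [Matrix.mul_assoc, sub_eq_add_neg]
  have h4 : (K - L)ᵀ * G * (K - L) =
      Kᵀ * G * K + Kᵀ * (Nᵀ * P * M) + Mᵀ * P * N * K - Mᵀ * P * N * L := by
    rw [transpose_sub, Matrix.sub_mul, h2, Matrix.mul_sub, Matrix.sub_mul, Matrix.sub_mul,
      Matrix.mul_assoc Kᵀ G L, h1]
    simp only [Matrix.mul_neg, Matrix.neg_mul]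
    abel
  rw [h3, h4, feedbackMap, hGdef]
  simp only [transpose_add, transpose_mul, Matrix.add_mul, Matrix.mul_add, Matrix.mul_assoc]
  abel

theorem feedbackMap_riccatiGain (hR : R.PosDef) {P : Matrix (Fin n) (Fin n) ℝ}
    (hP : P.PosSemidef) :
    feedbackMap M N Q R (riccatiGain M N R P) P = riccatiMap M N Q R P := by
  simp [feedbackMap_eq hR hP]

/-- The square left over in `feedbackMap_eq` is nonnegative: the Riccati gain minimizes the one-step
cost. -/
theorem quadForm_riccatiMap_le (hR : R.PosDef) {P : Matrix (Fin n) (Fin n) ℝ} (hP : P.PosSemidef)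
    (K : Matrix (Fin m) (Fin n) ℝ) (x : EVec n) :
    quadForm (riccatiMap M N Q R P) x ≤ quadForm (feedbackMap M N Q R K P) x := by
  rw [feedbackMap_eq hR hP, quadForm_add_matrix, ← quadForm_toEuclideanLin]
  linarith [quadForm_nonneg (posDef_add_conj (N := N) hR hP).posSemidef
    (toEuclideanLin (K - riccatiGain M N R P) x)]

theorem posDef_feedbackMap (hQ : Q.PosDef) (hR : R.PosDef) {P : Matrix (Fin n) (Fin n) ℝ}
    (hP : P.PosSemidef) (K : Matrix (Fin m) (Fin n) ℝ) :
    (feedbackMap M N Q R K P).PosDef := by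
  have h1 := hP.conjTranspose_mul_mul_same (M + N * K)
  have h2 := hR.posSemidef.conjTranspose_mul_mul_same K
  rw [conjTranspose_eq_transpose_of_trivial] at h1 h2
  exact PosDef.posSemidef_add (h1.add h2) hQ

/-- A supersolution of a feedback Lyapunov equation dominates every positive semidefinite
solution of the Riccati equation. -/
theorem quadForm_le_of_supersolution (hQ : Q.PosDef) (hR : R.PosDef)
    {P S : Matrix (Fin n) (Fin n) ℝ} (hP : P.PosSemidef) (hS : S.PosSemidef)
    (hPR : SolvesDARE M N Q R P) (K : Matrix (Fin m) (Fin n) ℝ)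
    (h : ∀ x, quadForm (feedbackMap M N Q R K S) x ≤ quadForm S x) (x : EVec n) :
    quadForm P x ≤ quadForm S x := by
  set F := toEuclideanLin (M + N * K)
  obtain ⟨q, hq, hqQ⟩ := exists_le_quadForm hQ
  obtain ⟨C, hC, hCP⟩ := exists_quadForm_le P
  -- Stage costs cancel, so the gap `P - S` can only grow along the orbit of `F`; as the orbit tends
  -- to zero, the gap is nonpositive at the start.
  have step : ∀ y, quadForm P y - quadForm S y ≤ quadForm P (F y) - quadForm S (F y) := by
    intro y
    have h1 := h y
    have h2 := quadForm_riccatiMap_le (M := M) (N := N) (Q := Q) hR hP K y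
    rw [quadForm_feedbackMap] at h1 h2
    have h3 : riccatiMap M N Q R P = P := hPR.symm
    rw [h3] at h2
    linarith
  have decr : ∀ y, q * ‖y‖ ^ 2 ≤ quadForm S y - quadForm S (F y) := by
    intro y
    have h1 := h y
    rw [quadForm_feedbackMap] at h1
    linarith [hqQ y, quadForm_nonneg hR.posSemidef (toEuclideanLin K y)]
  have iter : ∀ k : ℕ, quadForm P x - quadForm S x ≤
      quadForm P (F^[k] x) - quadForm S (F^[k] x) := by
    intro k
    induction k with
    | zero => simp
    | succ k ih =>
      rw [Function.iterate_succ_apply']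
      exact ih.trans (step _)
  have hsum : Summable fun k : ℕ => q * ‖F^[k] x‖ ^ 2 := by
    refine summable_of_sum_range_le (c := quadForm S x) (fun k => by positivity) fun k => ?_
    calc ∑ i ∈ Finset.range k, q * ‖F^[i] x‖ ^ 2
        ≤ ∑ i ∈ Finset.range k, (quadForm S (F^[i] x) - quadForm S (F^[i + 1] x)) := by
          refine Finset.sum_le_sum fun i _ => ?_
          rw [Function.iterate_succ_apply']
          exact decr _
      _ = quadForm S x - quadForm S (F^[k] x) := by
          rw [Finset.sum_range_sub' fun i => quadForm S (F^[i] x)]; rfl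
      _ ≤ quadForm S x := by linarith [quadForm_nonneg hS (F^[k] x)]
  have hlim : Filter.Tendsto (fun k : ℕ => C / q * (q * ‖F^[k] x‖ ^ 2)) Filter.atTop (nhds 0) := by
    simpa using hsum.tendsto_atTop_zero.const_mul (C / q)
  have : quadForm P x - quadForm S x ≤ 0 := by
    refine ge_of_tendsto' hlim fun k => (iter k).trans ?_
    have : C / q * (q * ‖F^[k] x‖ ^ 2) = C * ‖F^[k] x‖ ^ 2 := by field_simp
    rw [this]
    linarith [hCP (F^[k] x), quadForm_nonneg hS (F^[k] x)]
  linarith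

end Riccati

/-! ### From Schur stability to a positive definite Riccati solution. -/

section Stability

open Filter Topology

theorem exists_norm_toEuclideanLin_family_le {n m : ℕ} {E : Type*} [NormedAddCommGroup E]
    [NormedSpace ℝ E] [FiniteDimensional ℝ E] (T : E →ₗ[ℝ] Matrix (Fin m) (Fin n) ℝ) :
    ∃ C : ℝ, 0 < C ∧ ∀ v x, ‖toEuclideanLin (T v) x‖ ≤ C * ‖v‖ * ‖x‖ := by
  let Φ : E →L[ℝ] (EVec n →L[ℝ] EVec m) := LinearMap.toContinuousLinearMap
    ((LinearMap.toContinuousLinearMap : (EVec n →ₗ[ℝ] EVec m) ≃ₗ[ℝ] _).toLinearMap ∘ₗ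
      (toEuclideanLin : Matrix (Fin m) (Fin n) ℝ ≃ₗ[ℝ] _).toLinearMap ∘ₗ T)
  obtain ⟨C, hC, h⟩ := Φ.isBoundedLinearMap.bound
  refine ⟨C, hC, fun v x => ?_⟩
  calc ‖Φ v x‖ ≤ ‖Φ v‖ * ‖x‖ := (Φ v).le_opNorm x
    _ ≤ _ := by gcongr; exact h v

/-- In a complex Banach algebra, the powers of an element of spectral radius `< 1` tend to `0`. -/
theorem tendsto_norm_pow_of_spectralRadius_lt_one {𝒜 : Type*} [NormedRing 𝒜] [NormedAlgebra ℂ 𝒜]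
    [CompleteSpace 𝒜] {a : 𝒜} (ha : spectralRadius ℂ a < 1) :
    Tendsto (fun k : ℕ => ‖a ^ k‖) atTop (𝓝 0) := by
  obtain ⟨r, har, hr1⟩ := ENNReal.lt_iff_exists_nnreal_btwn.1 ha
  have hr1' : (r : ℝ) < 1 := by exact_mod_cast hr1
  have hev := (spectrum.pow_nnnorm_pow_one_div_tendsto_nhds_spectralRadius a).eventually_lt_const har
  refine squeeze_zero' (.of_forall fun _ => norm_nonneg _) ?_
    (tendsto_pow_atTop_nhds_zero_of_lt_one r.2 hr1')
  filter_upwards [hev, eventually_gt_atTop 0] with k hk hk0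
  have h1 := ENNReal.rpow_le_rpow hk.le (Nat.cast_nonneg k : (0 : ℝ) ≤ k)
  have hk0' : (k : ℝ) ≠ 0 := by exact_mod_cast hk0.ne'
  rw [← ENNReal.rpow_mul, one_div_mul_cancel hk0', ENNReal.rpow_one, ENNReal.rpow_natCast] at h1
  exact_mod_cast h1

-- Gelfand's formula for the complexified matrix; each entry is bounded by the row-sum norm. The
-- entrywise form keeps the statement free of the local choice of matrix norm.
attribute [local instance] Matrix.linftyOpNormedRing Matrix.linftyOpNormedAlgebra in
theorem IsSchurStable.tendsto_pow_apply {n : ℕ} {M : Matrix (Fin n) (Fin n) ℝ}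
    (hM : IsSchurStable M) (i j : Fin n) :
    Tendsto (fun k : ℕ => (M ^ k) i j) atTop (𝓝 0) := by
  have : Nonempty (Fin n) := ⟨i⟩
  have hrad : spectralRadius ℂ (M.map (algebraMap ℝ ℂ)) < 1 := by
    have := spectrum.spectralRadius_lt_of_forall_lt (M.map (algebraMap ℝ ℂ)) (r := 1)
      fun z hz => by exact_mod_cast hM z hz
    exact_mod_cast this
  refine squeeze_zero_norm (fun k => ?_) (tendsto_norm_pow_of_spectralRadius_lt_one hrad)
  have h1 : (M.map (algebraMap ℝ ℂ)) ^ k = (M ^ k).map (algebraMap ℝ ℂ) :=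
    (map_pow (algebraMap ℝ ℂ).mapMatrix M k).symm
  rw [h1, Matrix.linfty_opNorm_def]
  have h2 : ‖(M ^ k) i j‖₊ ≤ ∑ j, ‖(M ^ k).map (algebraMap ℝ ℂ) i j‖₊ := by
    refine le_trans ?_ (Finset.single_le_sum (f := fun j => ‖(M ^ k).map (algebraMap ℝ ℂ) i j‖₊)
      (fun _ _ => zero_le) (Finset.mem_univ j))
    simp
  exact_mod_cast h2.trans (Finset.le_sup (f := fun i =>
    ∑ j, ‖(M ^ k).map (algebraMap ℝ ℂ) i j‖₊) (Finset.mem_univ i))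

attribute [local instance] Matrix.normedAddCommGroup Matrix.normedSpace in
theorem IsSchurStable.exists_pow_quadForm_le {n : ℕ} {M : Matrix (Fin n) (Fin n) ℝ}
    (hM : IsSchurStable M) {W : Matrix (Fin n) (Fin n) ℝ} (hW : W.PosDef) :
    ∃ k : ℕ, ∀ x, quadForm W (toEuclideanLin (M ^ k) x) ≤ 1 / 2 * quadForm W x := by
  obtain ⟨q, hq, hqW⟩ := exists_le_quadForm hW
  obtain ⟨C, hC, hCW⟩ := exists_quadForm_le W
  obtain ⟨D, hD, hDT⟩ := exists_norm_toEuclideanLin_family_le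
    (LinearMap.id : Matrix (Fin n) (Fin n) ℝ →ₗ[ℝ] _)
  have hlim : Tendsto (fun k : ℕ => M ^ k) atTop (𝓝 0) :=
    tendsto_pi_nhds.2 fun i => tendsto_pi_nhds.2 fun j => hM.tendsto_pow_apply i j
  have hlim' : Tendsto (fun k : ℕ => C * (D * ‖M ^ k‖) ^ 2) atTop (𝓝 0) := by
    simpa using (((tendsto_norm_zero.comp hlim).const_mul D).pow 2).const_mul C
  obtain ⟨k, hk⟩ := (hlim'.eventually_le_const (show 0 < 1 / 2 * q by positivity)).exists
  refine ⟨k, fun x => ?_⟩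
  calc quadForm W (toEuclideanLin (M ^ k) x) ≤ C * ‖toEuclideanLin (M ^ k) x‖ ^ 2 := hCW _
    _ ≤ C * (D * ‖M ^ k‖ * ‖x‖) ^ 2 := by gcongr; exact hDT (M ^ k) x
    _ = C * (D * ‖M ^ k‖) ^ 2 * ‖x‖ ^ 2 := by ring
    _ ≤ 1 / 2 * q * ‖x‖ ^ 2 := by gcongr
    _ ≤ 1 / 2 * quadForm W x := by linarith [hqW x]

variable {n m : ℕ} {M : Matrix (Fin n) (Fin n) ℝ} {N : Matrix (Fin n) (Fin m) ℝ}
  {Q : Matrix (Fin n) (Fin n) ℝ} {R : Matrix (Fin m) (Fin m) ℝ}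

/-- A truncated Lyapunov series suffices. With `W` the stage cost and `S = 2 ∑_{i<k} (Fⁱ)ᵀ W Fⁱ`,
telescoping gives `FᵀSF - S = 2 (Fᵏ)ᵀ W Fᵏ - 2W`, which is at most `-W` once `Fᵏ` halves the form of
`W`. -/
theorem exists_supersolution_of_isStabilizable (hQ : Q.PosDef) (hR : R.PosDef)
    (h : IsStabilizable M N) : ∃ (S : Matrix (Fin n) (Fin n) ℝ) (K : Matrix (Fin m) (Fin n) ℝ),
      S.PosSemidef ∧ ∀ x, quadForm (feedbackMap M N Q R K S) x ≤ quadForm S x := by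
  obtain ⟨K, hK⟩ := h
  have hW : (Kᵀ * R * K + Q).PosDef := by
    have := hR.posSemidef.conjTranspose_mul_mul_same K
    rw [conjTranspose_eq_transpose_of_trivial] at this
    exact PosDef.posSemidef_add this hQ
  obtain ⟨k, hk⟩ := hK.exists_pow_quadForm_le hW
  set F := M + N * K with hFdef
  set W := Kᵀ * R * K + Q with hWdef
  have hS : ∀ x, quadForm ((2 : ℝ) • ∑ i ∈ Finset.range k, (F ^ i)ᵀ * W * F ^ i) x =
      2 * ∑ i ∈ Finset.range k, quadForm W (toEuclideanLin (F ^ i) x) := fun x => by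
    simp only [quadForm_smul_matrix, quadForm_sum_matrix, quadForm_toEuclideanLin]
  refine ⟨(2 : ℝ) • ∑ i ∈ Finset.range k, (F ^ i)ᵀ * W * F ^ i, K, ?_, fun x => ?_⟩
  · refine PosSemidef.smul (posSemidef_sum _ fun i _ => ?_) zero_le_two
    have := hW.posSemidef.conjTranspose_mul_mul_same (F ^ i)
    rwa [conjTranspose_eq_transpose_of_trivial] at this
  · have hWx : quadForm W x = quadForm R (toEuclideanLin K x) + quadForm Q x := by
      rw [hWdef, quadForm_add_matrix, quadForm_toEuclideanLin]
    have hF : ∀ i, toEuclideanLin (F ^ i) (toEuclideanLin F x) = toEuclideanLin (F ^ (i + 1)) x :=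
      fun i => by rw [pow_succ, toEuclideanLin_mul_apply]
    have htel := Finset.sum_range_sub (fun i => quadForm W (toEuclideanLin (F ^ i) x)) k
    rw [Finset.sum_sub_distrib] at htel
    have h0 : quadForm W (toEuclideanLin (F ^ 0) x) = quadForm W x := by simp
    rw [quadForm_feedbackMap, ← hFdef, hS, hS]
    simp only [hF]
    linarith [hk x]

theorem quadForm_single (P : Matrix (Fin n) (Fin n) ℝ) (i : Fin n) :
    quadForm P (EuclideanSpace.single i 1) = P i i := by
  simp [quadForm]

/-- Testing the form on `e_i ± e_j` gives `2|P i j| ≤ P i i + P j j`. -/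
theorem Matrix.PosSemidef.abs_apply_le_trace {P : Matrix (Fin n) (Fin n) ℝ} (hP : P.PosSemidef)
    (i j : Fin n) : |P i j| ≤ P.trace := by
  have hd : ∀ i, P i i ≤ P.trace := fun i =>
    Finset.single_le_sum (f := fun i => P i i) (fun i _ => hP.diag_nonneg) (Finset.mem_univ i)
  have hsym : P j i = P i j := congrFun (congrFun hP.transpose_eq i) j
  have h1 := quadForm_nonneg hP (EuclideanSpace.single i 1 + EuclideanSpace.single j 1)
  have h2 := quadForm_nonneg hP (EuclideanSpace.single i 1 - EuclideanSpace.single j 1)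
  simp [quadForm, mulVec_add, mulVec_sub, hsym] at h1 h2
  rw [abs_le]
  constructor <;> linarith [hd i, hd j]

/-- Among supersolutions, take one of least trace: a Riccati step turns it into a smaller
supersolution, so the step must fix it. -/
theorem exists_posDef_solvesDARE (hQ : Q.PosDef) (hR : R.PosDef) (h : IsStabilizable M N) :
    ∃ P : Matrix (Fin n) (Fin n) ℝ, P.PosDef ∧ SolvesDARE M N Q R P := by
  obtain ⟨S₀, K₀, hS₀, hSK₀⟩ := exists_supersolution_of_isStabilizable hQ hR h
  obtain ⟨r, hr, hrR⟩ := exists_le_quadForm hR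
  -- Keeping the gain in the pair makes every condition closed. The trace bounds `P`, and `r‖K e_j‖²
  -- ≤ P j j` then bounds `K`.
  let Z : Set (Matrix (Fin n) (Fin n) ℝ × Matrix (Fin m) (Fin n) ℝ) :=
    {p | p.1ᵀ = p.1 ∧ (∀ x, 0 ≤ quadForm p.1 x) ∧ p.1.trace ≤ S₀.trace ∧
      ∀ x, quadForm (feedbackMap M N Q R p.2 p.1) x ≤ quadForm p.1 x}
  have hclosed : IsClosed Z := by
    have hq1 : ∀ x : EVec n, Continuous
        fun p : Matrix (Fin n) (Fin n) ℝ × Matrix (Fin m) (Fin n) ℝ =>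
        quadForm p.1 x := fun x => by unfold quadForm; fun_prop
    have hq2 : ∀ x : EVec n, Continuous
        fun p : Matrix (Fin n) (Fin n) ℝ × Matrix (Fin m) (Fin n) ℝ =>
        quadForm (feedbackMap M N Q R p.2 p.1) x := fun x => by
      unfold quadForm feedbackMap; fun_prop
    have h1 : IsClosed {p : Matrix (Fin n) (Fin n) ℝ × Matrix (Fin m) (Fin n) ℝ | p.1ᵀ = p.1} :=
      isClosed_eq (by fun_prop) (by fun_prop)
    have h2 : IsClosed {p : Matrix (Fin n) (Fin n) ℝ × Matrix (Fin m) (Fin n) ℝ |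
        ∀ x, 0 ≤ quadForm p.1 x} := by
      rw [Set.ofPred_forall]
      exact isClosed_iInter fun x => isClosed_le continuous_const (hq1 x)
    have h3 : IsClosed {p : Matrix (Fin n) (Fin n) ℝ × Matrix (Fin m) (Fin n) ℝ |
        p.1.trace ≤ S₀.trace} := isClosed_le (by fun_prop) continuous_const
    have h4 : IsClosed {p : Matrix (Fin n) (Fin n) ℝ × Matrix (Fin m) (Fin n) ℝ |
        ∀ x, quadForm (feedbackMap M N Q R p.2 p.1) x ≤ quadForm p.1 x} := by
      rw [Set.ofPred_forall]
      exact isClosed_iInter fun x => isClosed_le (hq2 x) (hq1 x)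
    exact h1.inter (h2.inter (h3.inter h4))
  have hpsd : ∀ p ∈ Z, p.1.PosSemidef := fun p hp => posSemidef_of_quadForm_nonneg hp.1 hp.2.1
  let t := S₀.trace
  have hbound : ∀ p ∈ Z, (∀ i j, |p.1 i j| ≤ t) ∧ ∀ i j, |p.2 i j| ≤ √(t / r) := by
    rintro ⟨P, K⟩ hp
    have hP : P.PosSemidef := hpsd _ hp
    have htrace : P.trace ≤ t := hp.2.2.1
    refine ⟨fun i j => (hP.abs_apply_le_trace i j).trans htrace,
      fun i j => Real.abs_le_sqrt ?_⟩
    have h1 : quadForm (feedbackMap M N Q R K P) _ ≤ quadForm P _ :=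
      hp.2.2.2 (EuclideanSpace.single j 1)
    rw [quadForm_feedbackMap, quadForm_single P] at h1
    have h2 := (le_abs_self _).trans ((hP.abs_apply_le_trace j j).trans htrace)
    have h3 := hrR (toEuclideanLin K (EuclideanSpace.single j 1))
    have h4 : K i j ^ 2 ≤ ‖toEuclideanLin K (EuclideanSpace.single j 1)‖ ^ 2 := by
      have h5 := PiLp.norm_apply_le (toEuclideanLin K (EuclideanSpace.single j (1 : ℝ))) i
      have h6 : (toEuclideanLin K (EuclideanSpace.single j (1 : ℝ))).ofLp i = K i j := by simp
      rw [h6, Real.norm_eq_abs] at h5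
      rw [← sq_abs]
      gcongr
    change K i j ^ 2 ≤ t / r
    rw [le_div_iff₀ hr]
    nlinarith [quadForm_nonneg hP (toEuclideanLin (M + N * K) (EuclideanSpace.single j 1)),
      quadForm_nonneg hQ.posSemidef (EuclideanSpace.single j 1)]
  have hcompact : IsCompact Z := by
    refine IsCompact.of_isClosed_subset
      (s := (Set.univ.pi fun _ => Set.univ.pi fun _ => Set.Icc (-t) t) ×ˢ
        (Set.univ.pi fun _ => Set.univ.pi fun _ => Set.Icc (-√(t / r)) √(t / r)))
      ((isCompact_univ_pi fun _ => isCompact_univ_pi fun _ => isCompact_Icc).prod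
        (isCompact_univ_pi fun _ => isCompact_univ_pi fun _ => isCompact_Icc)) hclosed ?_
    exact fun p hp => ⟨fun i _ j _ => abs_le.1 ((hbound p hp).1 i j),
      fun i _ j _ => abs_le.1 ((hbound p hp).2 i j)⟩
  have hne : Z.Nonempty :=
    ⟨(S₀, K₀), hS₀.transpose_eq, fun x => quadForm_nonneg hS₀ x, le_rfl, hSK₀⟩
  obtain ⟨⟨S, K⟩, hSK, hmin⟩ := hcompact.exists_isMinOn hne
    (f := fun p => p.1.trace) (by fun_prop)
  have hS := hpsd _ hSK
  simp only at hS
  set L := riccatiGain M N R S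
  have hT := posDef_feedbackMap (M := M) (N := N) hQ hR hS L
  have hTL : feedbackMap M N Q R L S = riccatiMap M N Q R S := feedbackMap_riccatiGain hR hS
  rw [hTL] at hT
  have hle : ∀ x, quadForm (riccatiMap M N Q R S) x ≤ quadForm S x := fun x =>
    (quadForm_riccatiMap_le hR hS K x).trans (hSK.2.2.2 x)
  have hdiff : (S - riccatiMap M N Q R S).PosSemidef :=
    posSemidef_of_quadForm_nonneg
      (by rw [transpose_sub, hS.transpose_eq, hT.posSemidef.transpose_eq])
      fun x => by rw [quadForm_sub_matrix]; linarith [hle x]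
  have htr : (riccatiMap M N Q R S).trace ≤ S.trace := by
    have := hdiff.trace_nonneg
    rw [trace_sub] at this
    linarith
  have hmem : (riccatiMap M N Q R S, L) ∈ Z := by
    refine ⟨hT.posSemidef.transpose_eq, fun x => quadForm_nonneg hT.posSemidef x,
      htr.trans hSK.2.2.1, fun x => ?_⟩
    -- For a fixed gain the one-step cost is monotone in the terminal weight.
    calc quadForm (feedbackMap M N Q R L (riccatiMap M N Q R S)) x
        ≤ quadForm (feedbackMap M N Q R L S) x := by
          rw [quadForm_feedbackMap, quadForm_feedbackMap]
          linarith [hle (toEuclideanLin (M + N * L) x)]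
      _ = _ := by rw [hTL]
  have htr' : S.trace ≤ (riccatiMap M N Q R S).trace := hmin hmem
  -- A positive semidefinite matrix of trace zero vanishes.
  have heq : S - riccatiMap M N Q R S = 0 :=
    hdiff.trace_eq_zero_iff.1 (by rw [trace_sub]; linarith)
  have heq' : S = riccatiMap M N Q R S := sub_eq_zero.1 heq
  exact ⟨S, by rw [heq']; exact hT, heq'⟩

theorem dareSolution_spec (hQ : Q.PosDef) (hR : R.PosDef) (h : IsStabilizable M N) :
    (dareSolution M N Q R).PosDef ∧ SolvesDARE M N Q R (dareSolution M N Q R) :=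
  Classical.epsilon_spec (exists_posDef_solvesDARE hQ hR h)

/-- The Lyapunov identity for the LQR feedback. -/
theorem quadForm_dareSolution_eq (hQ : Q.PosDef) (hR : R.PosDef) (h : IsStabilizable M N)
    (x : EVec n) : quadForm (dareSolution M N Q R) x =
      quadForm (dareSolution M N Q R) (toEuclideanLin (M + N * lqrGain M N Q R) x) +
        quadForm R (toEuclideanLin (lqrGain M N Q R) x) + quadForm Q x := by
  obtain ⟨hP, hD⟩ := dareSolution_spec hQ hR h
  have h1 : riccatiMap M N Q R (dareSolution M N Q R) = dareSolution M N Q R := hD.symm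
  have h2 : lqrGain M N Q R = riccatiGain M N R (dareSolution M N Q R) := rfl
  rw [h2, ← quadForm_feedbackMap, feedbackMap_riccatiGain hR hP.posSemidef, h1]

end Stability

/-! ### Dependence of the value function on the parameter. -/

section Perturbation

open Topology

variable {n m p : ℕ} {A : EVec p →ᵃ[ℝ] Matrix (Fin n) (Fin n) ℝ}
  {B : EVec p →ᵃ[ℝ] Matrix (Fin n) (Fin m) ℝ}
  {Q : Matrix (Fin n) (Fin n) ℝ} {R : Matrix (Fin m) (Fin m) ℝ}

theorem lqrLyapunov_eq_quadForm (x : EVec n) (ϑ : EVec p) :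
    lqrLyapunov A B Q R x ϑ = quadForm (dareSolution (A ϑ) (B ϑ) Q R) x := rfl

theorem nominalStep_feedback (ϑ : EVec p) (K : Matrix (Fin m) (Fin n) ℝ) (x : EVec n) :
    nominalStep A B ϑ x (toEuclideanLin K x) = toEuclideanLin (A ϑ + B ϑ * K) x := by
  rw [nominalStep, map_add, LinearMap.add_apply, toEuclideanLin_mul_apply]

variable (A B) in
theorem exists_norm_nominalStep_sub_le : ∃ a b : ℝ, 0 < a ∧ 0 < b ∧ ∀ (ϑ ϑ' : EVec p) (x : EVec n)
    (u : EVec m), ‖nominalStep A B ϑ' x u - nominalStep A B ϑ x u‖ ≤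
      (a * ‖x‖ + b * ‖u‖) * ‖ϑ' - ϑ‖ := by
  obtain ⟨a, ha, hA⟩ := exists_norm_toEuclideanLin_family_le A.linear
  obtain ⟨b, hb, hB⟩ := exists_norm_toEuclideanLin_family_le B.linear
  refine ⟨a, b, ha, hb, fun ϑ ϑ' x u => ?_⟩
  have h : nominalStep A B ϑ' x u - nominalStep A B ϑ x u =
      toEuclideanLin (A.linear (ϑ' - ϑ)) x + toEuclideanLin (B.linear (ϑ' - ϑ)) u := by
    have h1 := A.linearMap_vsub ϑ' ϑ
    have h2 := B.linearMap_vsub ϑ' ϑ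
    rw [vsub_eq_sub, vsub_eq_sub] at h1 h2
    simp only [h1, h2, nominalStep, map_sub, LinearMap.sub_apply]
    abel
  rw [h]
  calc _ ≤ _ := norm_add_le _ _
    _ ≤ a * ‖ϑ' - ϑ‖ * ‖x‖ + b * ‖ϑ' - ϑ‖ * ‖u‖ := add_le_add (hA _ _) (hB _ _)
    _ = _ := by ring

theorem lqrLyapunov_eq (hQ : Q.PosDef) (hR : R.PosDef) {ϑ : EVec p}
    (h : IsStabilizable (A ϑ) (B ϑ)) (x : EVec n) :
    lqrLyapunov A B Q R x ϑ =
      lqrLyapunov A B Q R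
        (nominalStep A B ϑ x (toEuclideanLin (lqrGain (A ϑ) (B ϑ) Q R) x)) ϑ +
      quadForm R (toEuclideanLin (lqrGain (A ϑ) (B ϑ) Q R) x) + quadForm Q x := by
  rw [nominalStep_feedback]
  exact quadForm_dareSolution_eq hQ hR h x

theorem lqrLyapunov_nonneg (hQ : Q.PosDef) (hR : R.PosDef) {ϑ : EVec p}
    (h : IsStabilizable (A ϑ) (B ϑ)) (x : EVec n) : 0 ≤ lqrLyapunov A B Q R x ϑ :=
  quadForm_nonneg (dareSolution_spec hQ hR h).1.posSemidef x

theorem le_lqrLyapunov (hQ : Q.PosDef) (hR : R.PosDef) {ϑ : EVec p}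
    (h : IsStabilizable (A ϑ) (B ϑ)) {q : ℝ} (hq : ∀ x : EVec n, q * ‖x‖ ^ 2 ≤ quadForm Q x)
    (x : EVec n) : q * ‖x‖ ^ 2 ≤ lqrLyapunov A B Q R x ϑ := by
  rw [lqrLyapunov_eq hQ hR h]
  linarith [hq x, lqrLyapunov_nonneg hQ hR h
    (nominalStep A B ϑ x (toEuclideanLin (lqrGain (A ϑ) (B ϑ) Q R) x)),
    quadForm_nonneg hR.posSemidef (toEuclideanLin (lqrGain (A ϑ) (B ϑ) Q R) x)]

/-- The input cost is one nonnegative summand of the value: `r‖u‖² ≤ V ≤ Λ‖x‖²`. -/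
theorem norm_lqrGain_le (hQ : Q.PosDef) (hR : R.PosDef) {ϑ : EVec p}
    (h : IsStabilizable (A ϑ) (B ϑ)) {r Λ : ℝ} (hr : 0 < r)
    (hrR : ∀ u : EVec m, r * ‖u‖ ^ 2 ≤ quadForm R u)
    (hΛ : ∀ x, lqrLyapunov A B Q R x ϑ ≤ Λ * ‖x‖ ^ 2) (x : EVec n) :
    ‖toEuclideanLin (lqrGain (A ϑ) (B ϑ) Q R) x‖ ≤ √(Λ / r) * ‖x‖ := by
  have h1 := lqrLyapunov_eq hQ hR h x
  have h2 := lqrLyapunov_nonneg hQ hR h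
    (nominalStep A B ϑ x (toEuclideanLin (lqrGain (A ϑ) (B ϑ) Q R) x))
  have h3 := hrR (toEuclideanLin (lqrGain (A ϑ) (B ϑ) Q R) x)
  have h4 := quadForm_nonneg hQ.posSemidef x
  have h5 : ‖toEuclideanLin (lqrGain (A ϑ) (B ϑ) Q R) x‖ ^ 2 ≤ Λ / r * ‖x‖ ^ 2 := by
    rw [div_mul_eq_mul_div, le_div_iff₀ hr]
    linarith [hΛ x]
  calc _ = √(‖toEuclideanLin (lqrGain (A ϑ) (B ϑ) Q R) x‖ ^ 2) :=
        (Real.sqrt_sq (norm_nonneg _)).symm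
    _ ≤ √(Λ / r * ‖x‖ ^ 2) := Real.sqrt_le_sqrt h5
    _ = _ := by rw [Real.sqrt_mul' _ (sq_nonneg _), Real.sqrt_sq (norm_nonneg _)]

/-- Continuity of the Riccati solution in the parameter, locally uniformly: nearby parameters have
comparable value functions. -/
theorem exists_lqrLyapunov_le_of_norm_sub_le (hQ : Q.PosDef) (hR : R.PosDef) {s Λ : ℝ} (hs : 0 < s)
    (hΛ : 0 < Λ) : ∃ d : ℝ, 0 < d ∧ ∀ ϑ ϑ' : EVec p, IsStabilizable (A ϑ) (B ϑ) →
      IsStabilizable (A ϑ') (B ϑ') → (∀ x, lqrLyapunov A B Q R x ϑ ≤ Λ * ‖x‖ ^ 2) →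
      ‖ϑ' - ϑ‖ ≤ d → ∀ x, lqrLyapunov A B Q R x ϑ' ≤ (1 + s) * lqrLyapunov A B Q R x ϑ := by
  obtain ⟨q, hq, hqQ⟩ := exists_le_quadForm hQ
  obtain ⟨r, hr, hrR⟩ := exists_le_quadForm hR
  obtain ⟨a, b, ha, hb, hab⟩ := exists_norm_nominalStep_sub_le A B
  set D := a + b * √(Λ / r) with hD
  have hDpos : 0 < D := by positivity
  -- Inflating `P` by `1 + s` frees `s · xᵀQx ≥ (1 + s) η‖x‖²`. Half of `η` pays for the Young
  -- factor `τ`, half for the change of dynamics, whose cost is `κ‖ϑ' - ϑ‖²‖x‖²`.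
  set η := s / (1 + s) * q with hη
  have hηpos : 0 < η := by positivity
  set τ := η / (2 * Λ) with hτ
  have hτpos : 0 < τ := by positivity
  set κ := (1 + 1 / τ) * Λ * D ^ 2 with hκ
  have hκpos : 0 < κ := by positivity
  refine ⟨√(η / 2 / κ), Real.sqrt_pos.2 (by positivity), fun ϑ ϑ' hst hst' hV hdist => ?_⟩
  set P := dareSolution (A ϑ) (B ϑ) Q R
  set K := lqrGain (A ϑ) (B ϑ) Q R
  have hP : P.PosDef := (dareSolution_spec hQ hR hst).1
  obtain ⟨hP', hD'⟩ := dareSolution_spec hQ hR hst'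
  have hd2 : κ * ‖ϑ' - ϑ‖ ^ 2 ≤ η / 2 := by
    have : ‖ϑ' - ϑ‖ ^ 2 ≤ η / 2 / κ := 
      (Real.le_sqrt (norm_nonneg _) (by positivity)).1 hdist
    calc κ * ‖ϑ' - ϑ‖ ^ 2 ≤ κ * (η / 2 / κ) := by gcongr
      _ = η / 2 := by field_simp
  have hsuper : ∀ x, quadForm (feedbackMap (A ϑ') (B ϑ') Q R K ((1 + s) • P)) x ≤
      quadForm ((1 + s) • P) x := by
    intro x
    have h1 : quadForm P x = quadForm P (toEuclideanLin (A ϑ + B ϑ * K) x) +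
      quadForm R (toEuclideanLin K x) + quadForm Q x := quadForm_dareSolution_eq hQ hR hst x
    have hRx := quadForm_nonneg hR.posSemidef (toEuclideanLin K x)
    set F' := toEuclideanLin (A ϑ' + B ϑ' * K) x
    set F := toEuclideanLin (A ϑ + B ϑ * K) x
    have hy : ‖F' - F‖ ≤ D * ‖x‖ * ‖ϑ' - ϑ‖ := by
      have := hab ϑ ϑ' x (toEuclideanLin K x)
      rw [nominalStep_feedback, nominalStep_feedback] at this
      refine this.trans ?_
      gcongr
      have := norm_lqrGain_le hQ hR hst hr hrR hV x
      calc a * ‖x‖ + b * ‖toEuclideanLin K x‖ ≤ a * ‖x‖ + b * (√(Λ / r) * ‖x‖) := by gcongr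
        _ = D * ‖x‖ := by rw [hD]; ring
    have h2 := quadForm_add_le hP.posSemidef hτpos F (F' - F)
    rw [add_sub_cancel] at h2
    have h3 : (1 + 1 / τ) * quadForm P (F' - F) ≤ η / 2 * ‖x‖ ^ 2 :=
      calc (1 + 1 / τ) * quadForm P (F' - F) ≤ (1 + 1 / τ) * (Λ * (D * ‖x‖ * ‖ϑ' - ϑ‖) ^ 2) := by
            gcongr
            exact (hV _).trans (by gcongr)
        _ = κ * ‖ϑ' - ϑ‖ ^ 2 * ‖x‖ ^ 2 := by rw [hκ]; ring
        _ ≤ _ := by gcongr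
    have h4 : τ * quadForm P F ≤ η / 2 * ‖x‖ ^ 2 :=
      calc τ * quadForm P F ≤ τ * (Λ * ‖x‖ ^ 2) := by
            gcongr
            refine le_trans ?_ (hV x)
            rw [lqrLyapunov_eq_quadForm]
            linarith [quadForm_nonneg hQ.posSemidef x]
        _ = _ := by rw [hτ]; field_simp
    have h5 : (1 + s) * (η * ‖x‖ ^ 2) ≤ s * quadForm Q x :=
      calc (1 + s) * (η * ‖x‖ ^ 2) = s * (q * ‖x‖ ^ 2) := by rw [hη]; field_simp
        _ ≤ _ := by gcongr; exact hqQ x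
    rw [quadForm_feedbackMap, quadForm_smul_matrix, quadForm_smul_matrix]
    change (1 + s) * quadForm P F' + _ + _ ≤ _
    have h6 : (1 + s) * quadForm P F' ≤ (1 + s) * (quadForm P F + η * ‖x‖ ^ 2) := by
      gcongr
      linarith
    have h7 : 0 ≤ s * quadForm R (toEuclideanLin K x) := by positivity
    rw [h1]
    linarith
  intro x
  have := quadForm_le_of_supersolution hQ hR hP'.posSemidef
    (hP.posSemidef.smul (show 0 ≤ 1 + s by positivity)) hD' K hsuper x
  rwa [quadForm_smul_matrix] at this

/-- The value functions are uniformly bounded over a compact set of stabilizable parameters. -/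
theorem exists_lqrLyapunov_le_of_isCompact (hQ : Q.PosDef) (hR : R.PosDef) {Θ : Set (EVec p)}
    (hΘ : IsCompact Θ) (hst : ∀ ϑ ∈ Θ, IsStabilizable (A ϑ) (B ϑ)) :
    ∃ Λ : ℝ, 0 < Λ ∧ ∀ ϑ ∈ Θ, ∀ x, lqrLyapunov A B Q R x ϑ ≤ Λ * ‖x‖ ^ 2 := by
  -- The neighborhoods in the compactness induction may leave `Θ`, so membership is carried as a
  -- separate premise.
  suffices ∃ Λ : ℝ, 0 < Λ ∧ ∀ ϑ ∈ Θ, ϑ ∈ Θ → ∀ x, lqrLyapunov A B Q R x ϑ ≤ Λ * ‖x‖ ^ 2 by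
    obtain ⟨Λ, hΛ, h⟩ := this
    exact ⟨Λ, hΛ, fun ϑ hϑ => h ϑ hϑ hϑ⟩
  refine hΘ.induction_on (p := fun S => ∃ Λ : ℝ, 0 < Λ ∧ ∀ ϑ ∈ S, ϑ ∈ Θ →
    ∀ x, lqrLyapunov A B Q R x ϑ ≤ Λ * ‖x‖ ^ 2) ⟨1, one_pos, by simp⟩ ?_ ?_ ?_
  · rintro S T hST ⟨Λ, hΛ, h⟩
    exact ⟨Λ, hΛ, fun ϑ hϑ => h ϑ (hST hϑ)⟩
  · rintro S T ⟨Λ, hΛ, h⟩ ⟨Λ', hΛ', h'⟩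
    refine ⟨max Λ Λ', lt_max_of_lt_left hΛ, ?_⟩
    rintro ϑ (hϑ | hϑ) hϑΘ x
    · exact (h ϑ hϑ hϑΘ x).trans (by gcongr; exact le_max_left _ _)
    · exact (h' ϑ hϑ hϑΘ x).trans (by gcongr; exact le_max_right _ _)
  · intro ϑ hϑ
    obtain ⟨Λ, hΛ, h⟩ := exists_quadForm_le (dareSolution (A ϑ) (B ϑ) Q R)
    obtain ⟨d, hd, hdist⟩ := exists_lqrLyapunov_le_of_norm_sub_le (A := A) (B := B) hQ hR one_pos hΛ
    refine ⟨Metric.closedBall ϑ d, mem_nhdsWithin_of_mem_nhds (Metric.closedBall_mem_nhds ϑ hd),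
      2 * Λ, by positivity, fun ϑ' hϑ' hϑ'Θ x => ?_⟩
    have h1 := hdist ϑ ϑ' (hst ϑ hϑ) (hst ϑ' hϑ'Θ) h (by rwa [← dist_eq_norm]) x
    have h2 : lqrLyapunov A B Q R x ϑ ≤ Λ * ‖x‖ ^ 2 := h x
    linarith

end Perturbation

/-! ### One-step estimates for the state and for the estimator. -/

section ClosedLoop

variable {n m p : ℕ} {A : EVec p →ᵃ[ℝ] Matrix (Fin n) (Fin n) ℝ}
  {B : EVec p →ᵃ[ℝ] Matrix (Fin n) (Fin m) ℝ}
  {Q : Matrix (Fin n) (Fin n) ℝ} {R : Matrix (Fin m) (Fin m) ℝ}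

/-- One-step decrease of the LQR Lyapunov function under an additive perturbation `z` and a change
of the parameter from `ϑ` to `ϑ'`. -/
theorem lqrLyapunov_step_le (hQ : Q.PosDef) (hR : R.PosDef) {ϑ ϑ' : EVec p}
    (hst : IsStabilizable (A ϑ) (B ϑ)) {q Λ : ℝ} (hq : 0 < q) (hqΛ : q ≤ Λ)
    (hqQ : ∀ x : EVec n, q * ‖x‖ ^ 2 ≤ quadForm Q x)
    (hΛ : ∀ x, lqrLyapunov A B Q R x ϑ ≤ Λ * ‖x‖ ^ 2)
    (hϑ' : ∀ x, lqrLyapunov A B Q R x ϑ' ≤ (1 + q / (4 * Λ)) * lqrLyapunov A B Q R x ϑ)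
    (x z : EVec n) :
    lqrLyapunov A B Q R
        (nominalStep A B ϑ x (toEuclideanLin (lqrGain (A ϑ) (B ϑ) Q R) x) + z) ϑ' ≤
      lqrLyapunov A B Q R x ϑ - q / 2 * ‖x‖ ^ 2 + 2 * (1 + 4 * Λ / q) * Λ * ‖z‖ ^ 2 := by
  have hΛ0 : 0 < Λ := hq.trans_le hqΛ
  set y := nominalStep A B ϑ x (toEuclideanLin (lqrGain (A ϑ) (B ϑ) Q R) x)
  -- Chosen so that `s * V ≤ (q/4)‖x‖²`. It is spent twice, on Young's inequality and on the change
  -- of parameter, leaving `q/2` of the decrease `q`.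
  set s := q / (4 * Λ) with hs
  have hs0 : 0 < s := by positivity
  have hs1 : s ≤ 1 := by rw [hs, div_le_one (by positivity)]; linarith
  have hsinv : 1 / s = 4 * Λ / q := by rw [hs]; field_simp
  have hsΛ : s * Λ = q / 4 := by rw [hs]; field_simp
  have h1 : lqrLyapunov A B Q R (y + z) ϑ ≤
      (1 + s) * lqrLyapunov A B Q R y ϑ + (1 + 4 * Λ / q) * lqrLyapunov A B Q R z ϑ := by
    rw [← hsinv]
    exact quadForm_add_le (dareSolution_spec hQ hR hst).1.posSemidef hs0 y z
  have h2 := lqrLyapunov_eq hQ hR hst x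
  have h3 := quadForm_nonneg hR.posSemidef (toEuclideanLin (lqrGain (A ϑ) (B ϑ) Q R) x)
  set v := lqrLyapunov A B Q R x ϑ
  set c := (1 + 4 * Λ / q) * Λ with hc
  have hc0 : 0 < c := by positivity
  have h4 : lqrLyapunov A B Q R y ϑ ≤ v - q * ‖x‖ ^ 2 := by linarith [hqQ x]
  have h5 : (1 + 4 * Λ / q) * lqrLyapunov A B Q R z ϑ ≤ c * ‖z‖ ^ 2 := by
    rw [hc, mul_assoc]
    gcongr
    exact hΛ z
  have hsv : s * v ≤ q / 4 * ‖x‖ ^ 2 := by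
    rw [← hsΛ, mul_assoc]
    gcongr
    exact hΛ x
  have hsq : 0 ≤ s * (q * ‖x‖ ^ 2) := by positivity
  have h6 : lqrLyapunov A B Q R (y + z) ϑ ≤ v - 3 / 4 * q * ‖x‖ ^ 2 + c * ‖z‖ ^ 2 := by
    have : (1 + s) * lqrLyapunov A B Q R y ϑ ≤ (1 + s) * (v - q * ‖x‖ ^ 2) := by gcongr
    linarith
  have h7 : (1 + s) * lqrLyapunov A B Q R (y + z) ϑ ≤
      (1 + s) * (v - 3 / 4 * q * ‖x‖ ^ 2 + c * ‖z‖ ^ 2) := by gcongr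
  have h8 : s * (c * ‖z‖ ^ 2) ≤ 1 * (c * ‖z‖ ^ 2) := by gcongr
  have h9 : 2 * (1 + 4 * Λ / q) * Λ * ‖z‖ ^ 2 = c * ‖z‖ ^ 2 + 1 * (c * ‖z‖ ^ 2) := by
    rw [hc]; ring
  rw [h9]
  linarith [hϑ' (y + z)]

/-- The projection onto a convex set does not increase the distance to points of the set. -/
theorem IsProjection.norm_sub_le {S : Set (EVec p)} (hS : Convex ℝ S) {y z t : EVec p}
    (h : IsProjection S y z) (ht : t ∈ S) : ‖z - t‖ ≤ ‖y - t‖ := by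
  have : Nonempty S := ⟨⟨z, h.1⟩⟩
  have hinf : ‖y - z‖ = ⨅ w : S, ‖y - w‖ := by
    refine le_antisymm (le_ciInf fun w => ?_)
      (ciInf_le ⟨0, by rintro _ ⟨w, rfl⟩; exact norm_nonneg _⟩ (⟨z, h.1⟩ : S))
    rw [norm_sub_rev y z, norm_sub_rev y w]
    exact h.2 w w.2
  have hin := (norm_eq_iInf_iff_real_inner_le_zero hS h.1).1 hinf t ht
  have hsq : ‖y - t‖ ^ 2 = ‖y - z‖ ^ 2 - 2 * inner ℝ (y - z) (t - z) + ‖z - t‖ ^ 2 := by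
    have : y - t = (y - z) - (t - z) := by abel
    rw [this, norm_sub_sq_real, norm_sub_rev t z]
  exact le_of_sq_le_sq (by nlinarith [sq_nonneg ‖y - z‖]) (norm_nonneg _)

-- A Lipschitz bound in the parameter is an operator bound on the regressor; the transpose inherits
-- it via `‖Dᵀv‖² = ⟪v, D Dᵀv⟫`.
variable (A B) in
theorem norm_regressor_transpose_le {x : EVec n} {u : EVec m} {G : ℝ} (hG : 0 ≤ G)
    (h : ∀ ϑ ϑ' : EVec p, ‖nominalStep A B ϑ' x u - nominalStep A B ϑ x u‖ ≤ G * ‖ϑ' - ϑ‖)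
    (v : EVec n) : ‖toEuclideanLin (regressor A B x u)ᵀ v‖ ≤ G * ‖v‖ := by
  set y := toEuclideanLin (regressor A B x u)ᵀ v
  have h1 : ‖y‖ * ‖y‖ ≤ ‖v‖ * (G * ‖y‖) :=
    calc ‖y‖ * ‖y‖ = inner ℝ y y := (real_inner_self_eq_norm_mul_norm y).symm
      _ = inner ℝ v (toEuclideanLin (regressor A B x u) y) := inner_toEuclideanLin_transpose _ _ _
      _ ≤ ‖v‖ * ‖toEuclideanLin (regressor A B x u) y‖ := real_inner_le_norm _ _
      _ ≤ ‖v‖ * (G * ‖y‖) := by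
        gcongr
        simpa [nominalStep_eq_regressor A B y x u] using h 0 y
  obtain hy | hy := (norm_nonneg y).eq_or_lt
  · rw [← hy]; positivity
  · exact le_of_mul_le_mul_right (by linarith) hy

/-- Decrease of the squared estimation error in a gradient step with small step size. -/
theorem norm_sq_gradientStep_le {D : Matrix (Fin n) (Fin p) ℝ} {μ G : ℝ} (hμ : 0 < μ)
    (hμG : 4 * μ * G ^ 2 ≤ 1) (hD : ∀ v, ‖toEuclideanLin Dᵀ v‖ ≤ G * ‖v‖) (φ : EVec p)
    {e : EVec n} (he : e = -toEuclideanLin D φ) (w : EVec n) :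
    ‖φ + μ • toEuclideanLin Dᵀ (e + w)‖ ^ 2 ≤ ‖φ‖ ^ 2 - μ * ‖e‖ ^ 2 + 3 * μ * ‖w‖ ^ 2 := by
  have h1 : inner ℝ φ (toEuclideanLin Dᵀ (e + w)) = -(‖e‖ ^ 2 + inner ℝ e w) := by
    rw [real_inner_comm, inner_toEuclideanLin_transpose, real_inner_comm,
      show toEuclideanLin D φ = -e by rw [he, neg_neg], inner_neg_left,
      inner_add_right, real_inner_self_eq_norm_sq]
  have h2 : ‖toEuclideanLin Dᵀ (e + w)‖ ^ 2 ≤ G ^ 2 * ‖e + w‖ ^ 2 := by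
    rw [← mul_pow]
    gcongr
    exact hD _
  -- These two squares bound `‖e + w‖²` by `2‖e‖² + 2‖w‖²` and `-2⟪e, w⟫` by `‖e‖²/2 + 2‖w‖²`. Of
  -- the gain `2μ‖e‖²`, the cross term and the quadratic term each use up `μ/2`.
  have h3 : 0 ≤ ‖e - w‖ ^ 2 := sq_nonneg _
  have h4 : 0 ≤ ‖e + (2 : ℝ) • w‖ ^ 2 := sq_nonneg _
  have h5 := norm_add_sq_real e w
  rw [norm_sub_sq_real] at h3
  rw [norm_add_sq_real, inner_smul_right, norm_smul, Real.norm_ofNat, mul_pow] at h4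
  rw [norm_add_sq_real, inner_smul_right, h1, norm_smul, Real.norm_of_nonneg hμ.le, mul_pow]
  have h6 : μ ^ 2 * ‖toEuclideanLin Dᵀ (e + w)‖ ^ 2 ≤ μ / 4 * ‖e + w‖ ^ 2 :=
    calc μ ^ 2 * ‖toEuclideanLin Dᵀ (e + w)‖ ^ 2 ≤ μ ^ 2 * (G ^ 2 * ‖e + w‖ ^ 2) := by gcongr
      _ = 4 * μ * G ^ 2 * (μ / 4 * ‖e + w‖ ^ 2) := by ring
      _ ≤ 1 * (μ / 4 * ‖e + w‖ ^ 2) := by gcongr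
      _ = _ := one_mul _
  have h7 : μ / 4 * ‖e + w‖ ^ 2 ≤ μ / 4 * (2 * ‖e‖ ^ 2 + 2 * ‖w‖ ^ 2) := by
    gcongr
    linarith
  have h8 : 0 ≤ μ * (‖e‖ ^ 2 + 4 * inner ℝ e w + 4 * ‖w‖ ^ 2) := by
    apply mul_nonneg hμ.le
    linarith
  have h9 : 0 ≤ μ * ‖w‖ ^ 2 := by positivity
  linarith

end ClosedLoop

/-! ### Estimates along closed-loop trajectories. -/

section Trajectories

variable {n m p : ℕ} {A : EVec p →ᵃ[ℝ] Matrix (Fin n) (Fin n) ℝ}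
  {B : EVec p →ᵃ[ℝ] Matrix (Fin n) (Fin m) ℝ}
  {Q : Matrix (Fin n) (Fin n) ℝ} {R : Matrix (Fin m) (Fin m) ℝ}

variable (A B Q R) in
/-- The quantities that control the closed loop over a parameter set `Θ`: lower bounds `q`, `r` of
the weights, an upper bound `Λ` of the value functions, the Lipschitz constants `a`, `b` of the
dynamics in the parameter, and a bound `d` of the diameter of `Θ` that makes the value functions
comparable. -/
structure LoopConstants (Θ : Set (EVec p)) (q r Λ a b d : ℝ) : Prop where
  posDef_state : Q.PosDef
  posDef_input : R.PosDef
  convex : Convex ℝ Θ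
  stabilizable : ∀ ϑ ∈ Θ, IsStabilizable (A ϑ) (B ϑ)
  q_pos : 0 < q
  r_pos : 0 < r
  q_le : q ≤ Λ
  a_pos : 0 < a
  b_pos : 0 < b
  le_state : ∀ x : EVec n, q * ‖x‖ ^ 2 ≤ quadForm Q x
  le_input : ∀ u : EVec m, r * ‖u‖ ^ 2 ≤ quadForm R u
  value_le : ∀ ϑ ∈ Θ, ∀ x, lqrLyapunov A B Q R x ϑ ≤ Λ * ‖x‖ ^ 2
  lipschitz : ∀ (ϑ ϑ' : EVec p) (x : EVec n) (u : EVec m),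
    ‖nominalStep A B ϑ' x u - nominalStep A B ϑ x u‖ ≤ (a * ‖x‖ + b * ‖u‖) * ‖ϑ' - ϑ‖
  dist_le : ∀ ϑ ∈ Θ, ∀ ϑ' ∈ Θ, ‖ϑ' - ϑ‖ ≤ d
  value_compare : ∀ ϑ ∈ Θ, ∀ ϑ' ∈ Θ, ∀ x,
    lqrLyapunov A B Q R x ϑ' ≤ (1 + q / (4 * Λ)) * lqrLyapunov A B Q R x ϑ
  small : 4 * (1 + 4 * Λ / q) * Λ * ((a + b * √(Λ / r)) * d) ^ 2 ≤ q / 4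

variable {Θ : Set (EVec p)} {q r Λ a b d μ : ℝ} {θ θhat : ℕ → EVec p} {w x : ℕ → EVec n}
  {u : ℕ → EVec m}

theorem IsClosedLoop.estimate_mem (h : IsClosedLoop A B Q R Θ μ θ w x u θhat) (k : ℕ) :
    θhat k ∈ Θ := by
  cases k with
  | zero => exact h.init
  | succ k => exact (h.estimator k).1

theorem IsClosedLoop.predictionError_eq (h : IsClosedLoop A B Q R Θ μ θ w x u θhat) (k : ℕ) :
    x (k + 1) - nominalStep A B (θhat k) (x k) (u k) - w k =
      nominalStep A B (θ k) (x k) (u k) - nominalStep A B (θhat k) (x k) (u k) := by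
  rw [h.system k]
  abel

namespace LoopConstants

theorem Λ_pos (H : LoopConstants A B Q R Θ q r Λ a b d) : 0 < Λ := H.q_pos.trans_le H.q_le

theorem norm_input_le (H : LoopConstants A B Q R Θ q r Λ a b d)
    (h : IsClosedLoop A B Q R Θ μ θ w x u θhat) (k : ℕ) : ‖u k‖ ≤ √(Λ / r) * ‖x k‖ := by
  rw [h.control k]
  exact norm_lqrGain_le H.posDef_state H.posDef_input (H.stabilizable _ (h.estimate_mem k)) H.r_pos
    H.le_input (H.value_le _ (h.estimate_mem k)) _

/-- The parameter error is at most the diameter bound `d`, whatever the estimator does; hence no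
dependence on `μ`. -/
theorem norm_predictionError_le (H : LoopConstants A B Q R Θ q r Λ a b d) (hθ : ∀ k, θ k ∈ Θ)
    (h : IsClosedLoop A B Q R Θ μ θ w x u θhat) (k : ℕ) :
    ‖x (k + 1) - nominalStep A B (θhat k) (x k) (u k) - w k‖ ≤
      (a + b * √(Λ / r)) * d * ‖x k‖ := by
  have ha := H.a_pos
  have hb := H.b_pos
  rw [h.predictionError_eq]
  calc _ ≤ (a * ‖x k‖ + b * ‖u k‖) * ‖θ k - θhat k‖ := H.lipschitz _ _ _ _
    _ ≤ (a * ‖x k‖ + b * (√(Λ / r) * ‖x k‖)) * d := by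
      gcongr
      · exact H.norm_input_le h k
      · exact H.dist_le _ (h.estimate_mem k) _ (hθ k)
    _ = _ := by ring

/-- The decrease condition of the LQR Lyapunov function along the closed loop. -/
theorem lqrLyapunov_sub_le (H : LoopConstants A B Q R Θ q r Λ a b d)
    (h : IsClosedLoop A B Q R Θ μ θ w x u θhat) (k : ℕ) :
    lqrLyapunov A B Q R (x (k + 1)) (θhat (k + 1)) - lqrLyapunov A B Q R (x k) (θhat k) ≤
      -(q / 2) * ‖x k‖ ^ 2 + 4 * (1 + 4 * Λ / q) * Λ *
        ‖x (k + 1) - nominalStep A B (θhat k) (x k) (u k) - w k‖ ^ 2 +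
      4 * (1 + 4 * Λ / q) * Λ * ‖w k‖ ^ 2 := by
  have hq := H.q_pos
  have hΛ := H.Λ_pos
  set e := x (k + 1) - nominalStep A B (θhat k) (x k) (u k) - w k with he
  have hx : x (k + 1) = nominalStep A B (θhat k) (x k)
      (toEuclideanLin (lqrGain (A (θhat k)) (B (θhat k)) Q R) (x k)) + (e + w k) := by
    rw [← h.control k, he]
    abel
  have h1 := lqrLyapunov_step_le H.posDef_state H.posDef_input (H.stabilizable _ (h.estimate_mem k))
    hq H.q_le H.le_state (H.value_le _ (h.estimate_mem k))
    (H.value_compare _ (h.estimate_mem k) _ (h.estimate_mem (k + 1))) (x k) (e + w k)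
  rw [← hx] at h1
  have h2 : ‖e + w k‖ ^ 2 ≤ 2 * ‖e‖ ^ 2 + 2 * ‖w k‖ ^ 2 := by
    have h3 : 0 ≤ ‖e - w k‖ ^ 2 := sq_nonneg _
    rw [norm_sub_sq_real] at h3
    rw [norm_add_sq_real]
    linarith
  have h3 : 2 * (1 + 4 * Λ / q) * Λ * ‖e + w k‖ ^ 2 ≤
      2 * (1 + 4 * Λ / q) * Λ * (2 * ‖e‖ ^ 2 + 2 * ‖w k‖ ^ 2) := by gcongr
  linarith

/-- The state remains bounded, uniformly in the step size. -/
theorem norm_state_le (H : LoopConstants A B Q R Θ q r Λ a b d) (hθ : ∀ k, θ k ∈ Θ)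
    (h : IsClosedLoop A B Q R Θ μ θ w x u θhat) {W ρ : ℝ} (hw : ∀ k, ‖w k‖ ≤ W)
    (hx0 : ‖x 0‖ ≤ ρ) (k : ℕ) :
    ‖x k‖ ≤ √((Λ * ρ ^ 2 + 4 * Λ / q * (4 * (1 + 4 * Λ / q) * Λ * W ^ 2)) / q) := by
  have hq := H.q_pos
  have hΛ := H.Λ_pos
  set β := 4 * (1 + 4 * Λ / q) * Λ with hβ
  have hβ0 : 0 < β := by positivity
  -- After absorbing `e`, `V` obeys `V⁺ ≤ (1 - s) V + βW²` with `s = q/(4Λ)`. The level is the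
  -- initial bound plus the fixed point `βW²/s`.
  have hV : ∀ k, lqrLyapunov A B Q R (x k) (θhat k) ≤ Λ * ρ ^ 2 + 4 * Λ / q * (β * W ^ 2) := by
    intro k
    induction k with
    | zero =>
      have h1 := H.value_le _ (h.estimate_mem 0) (x 0)
      have h2 : Λ * ‖x 0‖ ^ 2 ≤ Λ * ρ ^ 2 := by gcongr
      have h3 : 0 ≤ 4 * Λ / q * (β * W ^ 2) := by positivity
      linarith
    | succ k ih =>
      have h1 := H.lqrLyapunov_sub_le h k
      have h2 := H.norm_predictionError_le hθ h k
      set e := x (k + 1) - nominalStep A B (θhat k) (x k) (u k) - w k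
      have h3 : β * ‖e‖ ^ 2 ≤ q / 4 * ‖x k‖ ^ 2 :=
        calc β * ‖e‖ ^ 2 ≤ β * ((a + b * √(Λ / r)) * d * ‖x k‖) ^ 2 := by gcongr
          _ = β * ((a + b * √(Λ / r)) * d) ^ 2 * ‖x k‖ ^ 2 := by ring
          _ ≤ _ := by gcongr; exact H.small
      have h4 : β * ‖w k‖ ^ 2 ≤ β * W ^ 2 := by gcongr; exact hw k
      set s := q / (4 * Λ) with hs
      have hs1 : s ≤ 1 := by rw [hs, div_le_one (by positivity)]; linarith [H.q_le]
      have hs0 : 0 < s := by positivity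
      have h5 : s * lqrLyapunov A B Q R (x k) (θhat k) ≤ q / 4 * ‖x k‖ ^ 2 :=
        calc s * lqrLyapunov A B Q R (x k) (θhat k) ≤ s * (Λ * ‖x k‖ ^ 2) := by
              gcongr
              exact H.value_le _ (h.estimate_mem k) _
          _ = _ := by rw [hs]; field_simp
      have h6 : s * (4 * Λ / q * (β * W ^ 2)) = β * W ^ 2 := by rw [hs]; field_simp
      have h7 : (1 - s) * lqrLyapunov A B Q R (x k) (θhat k) ≤
          (1 - s) * (Λ * ρ ^ 2 + 4 * Λ / q * (β * W ^ 2)) :=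
        mul_le_mul_of_nonneg_left ih (by linarith)
      have h8 : 0 ≤ s * (Λ * ρ ^ 2) := by positivity
      linarith
  refine Real.le_sqrt_of_sq_le ?_
  rw [le_div_iff₀ hq, mul_comm]
  exact (le_lqrLyapunov H.posDef_state H.posDef_input (H.stabilizable _ (h.estimate_mem k))
    H.le_state _).trans (hV k)

/-- Decrease of the squared estimation error along the closed loop. -/
theorem norm_estimationError_sq_le (H : LoopConstants A B Q R Θ q r Λ a b d)
    (hθ : ∀ k, θ k ∈ Θ) (h : IsClosedLoop A B Q R Θ μ θ w x u θhat) {X U : ℝ} (hμ : 0 < μ)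
    (hμX : 4 * μ * (a * X + b * U) ^ 2 ≤ 1) (hX : ∀ k, ‖x k‖ ≤ X) (hU : ∀ k, ‖u k‖ ≤ U) (k : ℕ) :
    ‖θhat (k + 1) - θ (k + 1)‖ ^ 2 ≤ ‖θhat k - θ k‖ ^ 2 -
      μ * ‖x (k + 1) - nominalStep A B (θhat k) (x k) (u k) - w k‖ ^ 2 + 3 * μ * ‖w k‖ ^ 2 +
      3 * d * ‖θ (k + 1) - θ k‖ := by
  have ha := H.a_pos
  have hb := H.b_pos
  have hX0 : 0 ≤ X := (norm_nonneg _).trans (hX 0)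
  have hU0 : 0 ≤ U := (norm_nonneg _).trans (hU 0)
  have hproj := (h.estimator k).norm_sub_le H.convex (hθ k)
  set D := regressor A B (x k) (u k)
  set e := x (k + 1) - nominalStep A B (θhat k) (x k) (u k) - w k with he
  have hew : x (k + 1) - nominalStep A B (θhat k) (x k) (u k) = e + w k := by rw [he]; abel
  have heD : e = -toEuclideanLin D (θhat k - θ k) := by
    rw [he, h.predictionError_eq, nominalStep_eq_regressor A B (θ k),
      nominalStep_eq_regressor A B (θhat k), map_sub]
    abel
  have hDT : ∀ v, ‖toEuclideanLin Dᵀ v‖ ≤ (a * X + b * U) * ‖v‖ :=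
    norm_regressor_transpose_le A B (by positivity) fun ϑ ϑ' => (H.lipschitz ϑ ϑ' _ _).trans (by
      gcongr
      · exact hX k
      · exact hU k)
  have hgrad := norm_sq_gradientStep_le hμ hμX hDT (θhat k - θ k) heD (w k)
  rw [hew, add_sub_right_comm] at hproj
  have h1 : ‖θhat (k + 1) - θ k‖ ^ 2 ≤
      ‖θhat k - θ k + μ • toEuclideanLin Dᵀ (e + w k)‖ ^ 2 := by gcongr
  have h2 : ‖θhat (k + 1) - θ (k + 1)‖ ≤ ‖θhat (k + 1) - θ k‖ + ‖θ (k + 1) - θ k‖ := by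
    have := norm_sub_le (θhat (k + 1) - θ k) (θ (k + 1) - θ k)
    rwa [sub_sub_sub_cancel_right] at this
  have h3 := H.dist_le _ (hθ k) _ (h.estimate_mem (k + 1))
  have h4 := H.dist_le _ (hθ k) _ (hθ (k + 1))
  have h5 : ‖θhat (k + 1) - θ (k + 1)‖ ^ 2 ≤
      (‖θhat (k + 1) - θ k‖ + ‖θ (k + 1) - θ k‖) ^ 2 := by gcongr
  -- The doubled cross term and the squared drift together give `3d`: the drift enters linearly
  -- because one factor is bounded by the diameter.
  have h6 : ‖θhat (k + 1) - θ k‖ * ‖θ (k + 1) - θ k‖ ≤ d * ‖θ (k + 1) - θ k‖ := by gcongr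
  have h7 : ‖θ (k + 1) - θ k‖ * ‖θ (k + 1) - θ k‖ ≤ d * ‖θ (k + 1) - θ k‖ := by gcongr
  linarith

/-- Decrease of the joint Lyapunov function along the closed loop. -/
theorem jointLyapunov_sub_le (H : LoopConstants A B Q R Θ q r Λ a b d)
    (hθ : ∀ k, θ k ∈ Θ) (h : IsClosedLoop A B Q R Θ μ θ w x u θhat) {X U β : ℝ} (hμ : 0 < μ)
    (hμX : 4 * μ * (a * X + b * U) ^ 2 ≤ 1) (hX : ∀ k, ‖x k‖ ≤ X) (hU : ∀ k, ‖u k‖ ≤ U)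
    (hβ : β = 4 * (1 + 4 * Λ / q) * Λ) (k : ℕ) :
    jointLyapunov A B Q R θ β μ (x (k + 1)) (θhat (k + 1) - θ (k + 1)) (k + 1) -
      jointLyapunov A B Q R θ β μ (x k) (θhat k - θ k) k ≤
      -(q / 2) * ‖x k‖ ^ 2 + (4 * β) * ‖w k‖ ^ 2 + β / μ * (3 * d) * ‖θ (k + 1) - θ k‖ := by
  have hq := H.q_pos
  have hΛ := H.Λ_pos
  have hβ0 : 0 < β := by rw [hβ]; positivity
  have h1 := H.lqrLyapunov_sub_le h k
  rw [← hβ] at h1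
  -- The weight `β/μ` turns `-μ‖e‖²` into `-β‖e‖²`, cancelling the error term of `V`; it also adds
  -- `3β` to the disturbance gain `β`.
  have h2 := mul_le_mul_of_nonneg_left
    (H.norm_estimationError_sq_le hθ h hμ hμX hX hU k) (div_pos hβ0 hμ).le
  simp only [jointLyapunov, sub_add_cancel]
  set e := x (k + 1) - nominalStep A B (θhat k) (x k) (u k) - w k
  have h3 : β / μ * (‖θhat k - θ k‖ ^ 2 - μ * ‖e‖ ^ 2 + 3 * μ * ‖w k‖ ^ 2 +
      3 * d * ‖θ (k + 1) - θ k‖) = β / μ * ‖θhat k - θ k‖ ^ 2 - β * ‖e‖ ^ 2 + 3 * β * ‖w k‖ ^ 2 +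
      β / μ * (3 * d) * ‖θ (k + 1) - θ k‖ := by
    field_simp
  linarith

theorem jointLyapunov_bounds (H : LoopConstants A B Q R Θ q r Λ a b d)
    (h : IsClosedLoop A B Q R Θ μ θ w x u θhat) {β : ℝ} (hμ : 0 < μ) (hβ : 0 < β) (k : ℕ) :
    min q (β / μ) * (‖x k‖ ^ 2 + ‖θhat k - θ k‖ ^ 2) ≤
        jointLyapunov A B Q R θ β μ (x k) (θhat k - θ k) k ∧
      jointLyapunov A B Q R θ β μ (x k) (θhat k - θ k) k ≤
        (Λ + β / μ) * (‖x k‖ ^ 2 + ‖θhat k - θ k‖ ^ 2) := by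
  have hΛ := H.Λ_pos
  have hβμ : 0 < β / μ := div_pos hβ hμ
  simp only [jointLyapunov, sub_add_cancel]
  constructor
  · have h1 := le_lqrLyapunov H.posDef_state H.posDef_input (H.stabilizable _ (h.estimate_mem k))
      H.le_state (x k)
    have h2 : min q (β / μ) * ‖x k‖ ^ 2 ≤ q * ‖x k‖ ^ 2 := by gcongr; exact min_le_left _ _
    have h3 : min q (β / μ) * ‖θhat k - θ k‖ ^ 2 ≤ β / μ * ‖θhat k - θ k‖ ^ 2 := by
      gcongr; exact min_le_right _ _
    linarith
  · have h1 := H.value_le _ (h.estimate_mem k) (x k)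
    have h2 : 0 ≤ Λ * ‖θhat k - θ k‖ ^ 2 := by positivity
    have h3 : 0 ≤ β / μ * ‖x k‖ ^ 2 := by positivity
    linarith

end LoopConstants

/-- Summing a dissipation inequality. -/
theorem sum_range_le_of_dissipation {v y s : ℕ → ℝ} {α : ℝ} (hα : 0 < α) (hv : ∀ k, 0 ≤ v k)
    (h : ∀ k, v (k + 1) - v k ≤ -α * y k + s k) (T : ℕ) :
    ∑ k ∈ Finset.range T, y k ≤ (v 0 + ∑ k ∈ Finset.range T, s k) / α := by
  have h1 := Finset.sum_le_sum fun k (_ : k ∈ Finset.range T) => h k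
  rw [Finset.sum_range_sub, Finset.sum_add_distrib, ← Finset.mul_sum] at h1
  rw [le_div_iff₀ hα]
  linarith [hv T]

variable (A B) in
/-- Over compact sets of stabilizable parameters, sets of small diameter admit closed-loop
constants. -/
theorem exists_loopConstants (hQ : Q.PosDef) (hR : R.PosDef) {Θ₀ : Set (EVec p)}
    (hΘ₀ : IsCompact Θ₀) (hstab : ∀ ϑ ∈ Θ₀, IsStabilizable (A ϑ) (B ϑ)) :
    ∃ q r Λ a b d : ℝ, 0 < d ∧ ∀ Θ : Set (EVec p), Θ ⊆ Θ₀ → IsCompact Θ → Convex ℝ Θ →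
      Metric.diam Θ ≤ d → LoopConstants A B Q R Θ q r Λ a b d := by
  obtain ⟨q, hq, hqQ⟩ := exists_le_quadForm hQ
  obtain ⟨r, hr, hrR⟩ := exists_le_quadForm hR
  obtain ⟨a, b, ha, hb, hab⟩ := exists_norm_nominalStep_sub_le A B
  obtain ⟨Λ', -, hΛ'⟩ := exists_lqrLyapunov_le_of_isCompact (A := A) (B := B) hQ hR hΘ₀ hstab
  -- Enlarging the bound to at least `q` ensures `q/(4Λ) ≤ 1`.
  have hqΛ := le_max_left q Λ'
  have hΛ : ∀ ϑ ∈ Θ₀, ∀ x, lqrLyapunov A B Q R x ϑ ≤ max q Λ' * ‖x‖ ^ 2 := fun ϑ hϑ x =>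
    (hΛ' ϑ hϑ x).trans (by gcongr; exact le_max_right _ _)
  set Λ := max q Λ'
  have hΛ0 : 0 < Λ := hq.trans_le hqΛ
  obtain ⟨d, hd, hcmp⟩ := exists_lqrLyapunov_le_of_norm_sub_le (A := A) (B := B) hQ hR
    (show 0 < q / (4 * Λ) by positivity) hΛ0
  set κ := 4 * (1 + 4 * Λ / q) * Λ * (a + b * √(Λ / r)) ^ 2 with hκ
  have hκ0 : 0 < κ := by positivity
  have hδ : 0 < √(q / 4 / κ) := Real.sqrt_pos.2 (by positivity)
  -- The first bound makes value functions comparable, the second makes the prediction error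
  -- absorbable.
  refine ⟨q, r, Λ, a, b, min d √(q / 4 / κ), lt_min hd hδ, fun Θ hsub hcpt hconv hdiam => ?_⟩
  have hdist : ∀ ϑ ∈ Θ, ∀ ϑ' ∈ Θ, ‖ϑ' - ϑ‖ ≤ min d √(q / 4 / κ) := fun ϑ hϑ ϑ' hϑ' => by
    rw [← dist_eq_norm]
    exact (Metric.dist_le_diam_of_mem hcpt.isBounded hϑ' hϑ).trans hdiam
  exact
    { posDef_state := hQ
      posDef_input := hR
      convex := hconv
      stabilizable := fun ϑ hϑ => hstab ϑ (hsub hϑ)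
      q_pos := hq
      r_pos := hr
      q_le := hqΛ
      a_pos := ha
      b_pos := hb
      le_state := hqQ
      le_input := hrR
      value_le := fun ϑ hϑ => hΛ ϑ (hsub hϑ)
      lipschitz := hab
      dist_le := hdist
      value_compare := fun ϑ hϑ ϑ' hϑ' => hcmp ϑ ϑ' (hstab ϑ (hsub hϑ)) (hstab ϑ' (hsub hϑ'))
        (hΛ ϑ (hsub hϑ)) ((hdist ϑ hϑ ϑ' hϑ').trans (min_le_left _ _))
      small :=
        calc 4 * (1 + 4 * Λ / q) * Λ * ((a + b * √(Λ / r)) * min d √(q / 4 / κ)) ^ 2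
            = κ * (min d √(q / 4 / κ)) ^ 2 := by rw [hκ]; ring
          _ ≤ κ * √(q / 4 / κ) ^ 2 := by gcongr; exact min_le_right _ _
          _ = κ * (q / 4 / κ) := by rw [Real.sq_sqrt (by positivity)]
          _ = q / 4 := by field_simp }

end Trajectories

/-! ### The main theorem: choice of constants and assembly. -/

theorem theorem1 {n m p : ℕ} (A : EVec p →ᵃ[ℝ] Matrix (Fin n) (Fin n) ℝ)
    (B : EVec p →ᵃ[ℝ] Matrix (Fin n) (Fin m) ℝ)
    (Q : Matrix (Fin n) (Fin n) ℝ) (R : Matrix (Fin m) (Fin m) ℝ) (hQ : Q.PosDef) (hR : R.PosDef)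
    (Θ₀ : Set (EVec p)) (hΘ₀ : IsCompact Θ₀)
    (hstab : ∀ ϑ ∈ Θ₀, IsStabilizable (A ϑ) (B ϑ)) :
    ∃ d₀ : ℝ, 0 < d₀ ∧
      ∀ Θ : Set (EVec p), Θ ⊆ Θ₀ → IsCompact Θ → Convex ℝ Θ → Metric.diam Θ ≤ d₀ →
      ∀ W r : ℝ, 0 ≤ W → 0 ≤ r →
      ∃ μ₀ : ℝ, 0 < μ₀ ∧ ∀ μ : ℝ, 0 < μ → μ ≤ μ₀ →
        ∃ X U α β γ α' γ' δ' clow cup c₁ c₂ c₃ c₄ : ℝ,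
          0 < X ∧ 0 < U ∧ 0 < α ∧ 0 < β ∧ 0 < γ ∧ 0 < α' ∧ 0 < γ' ∧ 0 < δ' ∧ 0 < clow ∧ 0 < cup ∧
          0 < c₁ ∧ 0 < c₂ ∧ 0 < c₃ ∧ 0 < c₄ ∧
          -- the three properties, along every closed-loop trajectory
          (∀ (θ : ℕ → EVec p) (w x : ℕ → EVec n) (u : ℕ → EVec m) (θhat φ : ℕ → EVec p),
            (∀ k, θ k ∈ Θ) → (∀ k, ‖w k‖ ≤ W) → ‖x 0‖ ≤ r →
            IsClosedLoop A B Q R Θ μ θ w x u θhat → (∀ k, φ k = θhat k - θ k) →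
            -- (a) boundedness of state and input
            (∀ k, ‖x k‖ ≤ X ∧ ‖u k‖ ≤ U) ∧
            -- the weight `β` of the joint Lyapunov function comes from the LQR decrease condition
            (∀ k, lqrLyapunov A B Q R (x (k + 1)) (θhat (k + 1)) -
                lqrLyapunov A B Q R (x k) (θhat k) ≤
              -α * ‖x k‖ ^ 2 +
                β * ‖x (k + 1) - nominalStep A B (θhat k) (x k) (u k) - w k‖ ^ 2 +
                γ * ‖w k‖ ^ 2) ∧
            -- (b) quadratic bounds and decrease of the joint Lyapunov function
            (∀ k, clow * (‖x k‖ ^ 2 + ‖φ k‖ ^ 2) ≤ jointLyapunov A B Q R θ β μ (x k) (φ k) k ∧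
              jointLyapunov A B Q R θ β μ (x k) (φ k) k ≤ cup * (‖x k‖ ^ 2 + ‖φ k‖ ^ 2)) ∧
            (∀ k, jointLyapunov A B Q R θ β μ (x (k + 1)) (φ (k + 1)) (k + 1) -
                jointLyapunov A B Q R θ β μ (x k) (φ k) k ≤
              -α' * ‖x k‖ ^ 2 + γ' * ‖w k‖ ^ 2 + δ' * ‖θ (k + 1) - θ k‖) ∧
            -- (c) the cumulative bound on the state
            (∀ T : ℕ, ∑ k ∈ Finset.range (T + 1), ‖x k‖ ^ 2 ≤
              c₁ * ‖x 0‖ ^ 2 + c₂ * ‖φ 0‖ ^ 2 + c₃ * ∑ k ∈ Finset.range (T + 1), ‖w k‖ ^ 2 +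
                c₄ * ∑ k ∈ Finset.range (T + 1), ‖θ (k + 1) - θ k‖)) ∧
          -- finite-gain stability when the parameter variation is summable
          (∀ (θ : ℕ → EVec p) (x₀ : EVec n) (ϑ₀ : EVec p), (∀ k, θ k ∈ Θ) → ‖x₀‖ ≤ r → ϑ₀ ∈ Θ →
            Summable (fun k => ‖θ (k + 1) - θ k‖) →
            IsFiniteGainL2Stable fun w x => (∀ k, ‖w k‖ ≤ W) ∧
              ∃ (u : ℕ → EVec m) (θhat : ℕ → EVec p), x 0 = x₀ ∧ θhat 0 = ϑ₀ ∧
                IsClosedLoop A B Q R Θ μ θ w x u θhat) := by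
  obtain ⟨q, r, Λ, a, b, d, hd, hloop⟩ := exists_loopConstants A B hQ hR hΘ₀ hstab
  refine ⟨d, hd, fun Θ hsub hcpt hconv hdiam W ρ hW hρ => ?_⟩
  have H := hloop Θ hsub hcpt hconv hdiam
  have hq := H.q_pos
  have hr := H.r_pos
  have hΛ := H.Λ_pos
  have ha := H.a_pos
  have hb := H.b_pos
  obtain ⟨β, hβ⟩ : ∃ β, β = 4 * (1 + 4 * Λ / q) * Λ := ⟨_, rfl⟩
  have hβ0 : 0 < β := by rw [hβ]; positivity
  -- The added `1` keeps the bound positive when `ρ = W = 0`.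
  obtain ⟨X, hX⟩ : ∃ X, X = √((Λ * ρ ^ 2 + 4 * Λ / q * (β * W ^ 2)) / q) + 1 := ⟨_, rfl⟩
  have hX0 : 0 < X := by rw [hX]; positivity
  obtain ⟨U, hU⟩ : ∃ U, U = √(Λ / r) * X + 1 := ⟨_, rfl⟩
  have hU0 : 0 < U := by rw [hU]; positivity
  refine ⟨1 / (4 * (a * X + b * U) ^ 2), by positivity, fun μ hμ hμ₀ => ?_⟩
  have hμX : 4 * μ * (a * X + b * U) ^ 2 ≤ 1 := by
    rw [le_div_iff₀ (by positivity)] at hμ₀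
    linarith
  have hβμ : 0 < β / μ := div_pos hβ0 hμ
  have hx : ∀ {θ : ℕ → EVec p} {w x : ℕ → EVec n} {u : ℕ → EVec m} {θhat : ℕ → EVec p},
      (∀ k, θ k ∈ Θ) → (∀ k, ‖w k‖ ≤ W) → ‖x 0‖ ≤ ρ →
      IsClosedLoop A B Q R Θ μ θ w x u θhat → ∀ k, ‖x k‖ ≤ X ∧ ‖u k‖ ≤ U := by
    intro θ w x u θhat hθ hw hx0 h k
    have h1 : ‖x k‖ ≤ X := by
      have := H.norm_state_le hθ h hw hx0 k
      rw [← hβ] at this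
      linarith
    refine ⟨h1, ?_⟩
    calc ‖u k‖ ≤ √(Λ / r) * ‖x k‖ := H.norm_input_le h k
      _ ≤ √(Λ / r) * X := by gcongr
      _ ≤ U := by rw [hU]; linarith
  have hdec : ∀ {θ : ℕ → EVec p} {w x : ℕ → EVec n} {u : ℕ → EVec m} {θhat : ℕ → EVec p},
      (∀ k, θ k ∈ Θ) → (∀ k, ‖w k‖ ≤ W) → ‖x 0‖ ≤ ρ →
      IsClosedLoop A B Q R Θ μ θ w x u θhat → ∀ k,
      jointLyapunov A B Q R θ β μ (x (k + 1)) (θhat (k + 1) - θ (k + 1)) (k + 1) -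
        jointLyapunov A B Q R θ β μ (x k) (θhat k - θ k) k ≤
      -(q / 2) * ‖x k‖ ^ 2 + (4 * β) * ‖w k‖ ^ 2 + β / μ * (3 * d) * ‖θ (k + 1) - θ k‖ :=
    fun hθ hw hx0 h => H.jointLyapunov_sub_le hθ h hμ hμX (fun k => (hx hθ hw hx0 h k).1)
      (fun k => (hx hθ hw hx0 h k).2) hβ
  have hsum : ∀ {θ : ℕ → EVec p} {w x : ℕ → EVec n} {u : ℕ → EVec m} {θhat : ℕ → EVec p},
      (∀ k, θ k ∈ Θ) → (∀ k, ‖w k‖ ≤ W) → ‖x 0‖ ≤ ρ →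
      IsClosedLoop A B Q R Θ μ θ w x u θhat → ∀ T : ℕ,
      ∑ k ∈ Finset.range (T + 1), ‖x k‖ ^ 2 ≤
        (Λ + β / μ) / (q / 2) * ‖x 0‖ ^ 2 + (Λ + β / μ) / (q / 2) * ‖θhat 0 - θ 0‖ ^ 2 +
        4 * β / (q / 2) * ∑ k ∈ Finset.range (T + 1), ‖w k‖ ^ 2 +
        β / μ * (3 * d) / (q / 2) * ∑ k ∈ Finset.range (T + 1), ‖θ (k + 1) - θ k‖ := by
    intro θ w x u θhat hθ hw hx0 h T
    have hbd := fun k => H.jointLyapunov_bounds h hμ hβ0 k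
    have h1 := sum_range_le_of_dissipation (half_pos hq)
      (v := fun k => jointLyapunov A B Q R θ β μ (x k) (θhat k - θ k) k)
      (y := fun k => ‖x k‖ ^ 2)
      (s := fun k => (4 * β) * ‖w k‖ ^ 2 + β / μ * (3 * d) * ‖θ (k + 1) - θ k‖)
      (fun k => le_trans (mul_nonneg (lt_min hq hβμ).le (by positivity)) (hbd k).1)
      (fun k => (hdec hθ hw hx0 h k).trans_eq (add_assoc _ _ _)) (T + 1)
    rw [Finset.sum_add_distrib, ← Finset.mul_sum, ← Finset.mul_sum] at h1
    refine h1.trans ?_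
    calc _ ≤ ((Λ + β / μ) * (‖x 0‖ ^ 2 + ‖θhat 0 - θ 0‖ ^ 2) +
          (4 * β * ∑ k ∈ Finset.range (T + 1), ‖w k‖ ^ 2 +
            β / μ * (3 * d) * ∑ k ∈ Finset.range (T + 1), ‖θ (k + 1) - θ k‖)) / (q / 2) := by
          gcongr
          exact (hbd 0).2
      _ = _ := by ring
  refine ⟨X, U, q / 2, β, β, q / 2, 4 * β, β / μ * (3 * d), min q (β / μ), Λ + β / μ,
    (Λ + β / μ) / (q / 2), (Λ + β / μ) / (q / 2), 4 * β / (q / 2), β / μ * (3 * d) / (q / 2),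
    hX0, hU0, by positivity, hβ0, hβ0, by positivity, by positivity, by positivity,
    lt_min hq hβμ, by positivity, by positivity, by positivity, by positivity, by positivity,
    ?_, ?_⟩
  · intro θ w x u θhat φ hθ hw hx0 h hφ
    obtain rfl : φ = fun k => θhat k - θ k := funext hφ
    refine ⟨hx hθ hw hx0 h, ?_, H.jointLyapunov_bounds h hμ hβ0, hdec hθ hw hx0 h,
      hsum hθ hw hx0 h⟩
    rw [hβ]
    exact H.lqrLyapunov_sub_le h
  · intro θ x₀ ϑ₀ hθ hx₀ hϑ₀ hΔ
    -- The bias collects the initial data and the total parameter variation, so it is common to all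
    -- disturbances.
    refine ⟨4 * β / (q / 2), (Λ + β / μ) / (q / 2) * ‖x₀‖ ^ 2 +
      (Λ + β / μ) / (q / 2) * ‖ϑ₀ - θ 0‖ ^ 2 +
      β / μ * (3 * d) / (q / 2) * ∑' k, ‖θ (k + 1) - θ k‖, by positivity, ?_, ?_⟩
    · have : 0 ≤ ∑' k, ‖θ (k + 1) - θ k‖ := tsum_nonneg fun _ => norm_nonneg _
      positivity
    · rintro w x ⟨hw, u, θhat, rfl, rfl, h⟩ - T
      have h1 := hsum hθ hw hx₀ h T
      have h2 : β / μ * (3 * d) / (q / 2) * ∑ k ∈ Finset.range (T + 1), ‖θ (k + 1) - θ k‖ ≤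
          β / μ * (3 * d) / (q / 2) * ∑' k, ‖θ (k + 1) - θ k‖ := by
        gcongr
        exact hΔ.sum_le_tsum _ fun _ _ => norm_nonneg _
      linarith
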